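/- Let $\mathrm{nil}_3$ be the Heisenberg group of real unitriangular $3\times 3$ matrices, with coordinates $(x,y,z)$ ($x,y$ the entries above the diagonal, $z$ the corner entry), let $\tilde{\mathbb Z}=\{(0,0,2\pi n): n\in\mathbb Z\}$ be the indicated central cyclic subgroup, and $G=\mathrm{nil}_3/\tilde{\mathbb Z}$. The center $K=\{(0,0,z)\}\cong SO(2)$ of $G$ acts on $\mathbb R^2=\mathbb C$ by the rotations $e^{iz}$; let $M=G\times_{K}\mathbb R^2$ be the quotient of $G\times\mathbb R^2$ by $(h,v)\sim(hk^{-1},kv)$, $k\in K$, a smooth $4$-manifold. The complement of the singular orbit $G/K$ (the zero section of $M$) is identified with $G\times\mathbb R$ by $(h,q)\mapsto[h,(e^q,0)]$. Let $\sigma_1=dx$, $\sigma_2=dy$, $\sigma_3=x\,dy-dz$ be the left-invariant coframe of $G$, with dual frame $X_1=\partial_x$, $X_2=\partial_y+x\partial_z$, $X_3=-\partial_z$. Then for every $c_1>0$ the metric \[ g=\frac{e^{2q}}{\sqrt{e^{2q}+c_1^2}}\,(dq^2+\sigma_3^2)+\sqrt{e^{2q}+c_1^2}\,(\sigma_1^2+\sigma_2^2),\qquad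 q\in\mathbb R, \] on this complement extends to a smooth Riemannian metric on all of $M$, again denoted $g$, which is complete. The almost complex structure with $J\partial_q=X_3$, $JX_1=X_2$ also extends smoothly to $M$, and $(g,J)$ is a Kähler structure on $M$, whose Kähler form $\omega=g(J\cdot,\cdot)$ is $\frac{e^{2q}}{\sqrt{e^{2q}+c_1^2}}\,dq\wedge\sigma_3+\sqrt{e^{2q}+c_1^2}\;\sigma_1\wedge\sigma_2$ on the complement of the singular orbit. Moreover $(g,J)$ is centrally flat: the Ricci form $\rho=\mathrm{Ric}(J\cdot,\cdot)$ satisfies $\rho\wedge\rho=0$, and the determinant of the Ricci endomorphism of $g$ vanishes identically on $M$. The metric $g$ is not Ricci-flat. -/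

import Mathlib

open scoped Manifold ContDiff Topology Bundle

attribute [-instance] TopCat.of.chartedSpace

noncomputable section

/-! ## Riemannian geometry in charts -/

/-- The model space of `n`-manifolds. -/
abbrev Mdl (n : ℕ) : Type := EuclideanSpace ℝ (Fin n)

/-- The partial derivative `∂ᵢ f`. -/
def pderiv {n : ℕ} (i : Fin n) (f : Mdl n → ℝ) (y : Mdl n) : ℝ :=
  fderiv ℝ f y (EuclideanSpace.single i 1)

/-- Christoffel symbol `Γᵏᵢⱼ` of the metric with coefficient matrix `h`. -/
def christoffel {n : ℕ} (h : Mdl n → Matrix (Fin n) (Fin n) ℝ) (k i j : Fin n) (y : Mdl n) : ℝ :=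
  (1 / 2) * ∑ l, (h y)⁻¹ k l *
    (pderiv i (fun w => h w j l) y + pderiv j (fun w => h w i l) y - pderiv l (fun w => h w i j) y)

/-- Components of the curvature tensor: `R(∂ᵢ, ∂ⱼ)∂ₖ = ∑ₗ Rˡₖᵢⱼ ∂ₗ`, where
`R(X,Y) = ∇_X ∇_Y - ∇_Y ∇_X - ∇_[X,Y]`. -/
def riemCoeff {n : ℕ} (h : Mdl n → Matrix (Fin n) (Fin n) ℝ) (l k i j : Fin n) (y : Mdl n) : ℝ :=
  pderiv i (christoffel h l j k) y - pderiv j (christoffel h l i k) y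
    + ∑ m, (christoffel h l i m y * christoffel h m j k y
      - christoffel h l j m y * christoffel h m i k y)

/-- The matrix of the Ricci tensor `Ric(Y,Z) = trace (X ↦ R(X,Y)Z)`. -/
def ricciCoeff {n : ℕ} (h : Mdl n → Matrix (Fin n) (Fin n) ℝ) (y : Mdl n) :
    Matrix (Fin n) (Fin n) ℝ :=
  Matrix.of fun j k => ∑ i, riemCoeff h i k i j y

section Riemannian

variable {n : ℕ} {M : Type*} [TopologicalSpace M] [ChartedSpace (Mdl n) M] [IsManifold (𝓡 n) ∞ M]

variable (n M) in
/-- Smooth Riemannian metrics on `M`. -/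
abbrev RiemMetric := Bundle.ContMDiffRiemannianMetric (𝓡 n) ∞ (Mdl n)
  (fun x : M => TangentSpace (𝓡 n) x)

variable (n) in
/-- The coordinate vector field `∂ᵢ` of the preferred chart around `p`, at the point with
coordinates `y`. -/
def coordVec (p : M) (y : Mdl n) (i : Fin n) :
    TangentSpace (𝓡 n) ((extChartAt (𝓡 n) p).symm y) :=
  mfderiv (𝓡 n) (𝓡 n) (extChartAt (𝓡 n) p).symm y (EuclideanSpace.single i 1)

/-- The components of a tangent vector at `p` in the preferred chart around `p`. -/
def vecCoord (p : M) (u : TangentSpace (𝓡 n) p) : Mdl n :=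
  mfderiv (𝓡 n) (𝓡 n) (extChartAt (𝓡 n) p) p u

/-- The coefficient matrix `gᵢⱼ` of the metric in the preferred chart around `p`. -/
def metricCoeff (g : RiemMetric n M) (p : M) (y : Mdl n) : Matrix (Fin n) (Fin n) ℝ :=
  Matrix.of fun i j => g.inner ((extChartAt (𝓡 n) p).symm y) (coordVec n p y i) (coordVec n p y j)

/-- The matrix of the Ricci tensor at `p` in the preferred chart around `p`. -/
def ricciMatrix (g : RiemMetric n M) (p : M) : Matrix (Fin n) (Fin n) ℝ :=
  ricciCoeff (metricCoeff g p) (extChartAt (𝓡 n) p p)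

/-- The Ricci tensor. -/
def ricci (g : RiemMetric n M) (p : M) (u v : TangentSpace (𝓡 n) p) : ℝ :=
  ∑ i, ∑ j, ricciMatrix g p i j * vecCoord p u i * vecCoord p v j

/-- The determinant at `p` of the Ricci endomorphism, i.e. of the endomorphism `A` of `T_p M`
such that `g(A u, v) = Ric(u, v)`. -/
def ricciDet (g : RiemMetric n M) (p : M) : ℝ :=
  ((metricCoeff g p (extChartAt (𝓡 n) p p))⁻¹ * ricciMatrix g p).det

def IsRicciFlat (g : RiemMetric n M) : Prop :=
  ∀ (p : M) (u v : TangentSpace (𝓡 n) p), ricci g p u v = 0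

/-- The Riemannian distance: the infimum of the lengths of `C¹` paths. -/
def riemDist (g : RiemMetric n M) (p q : M) : ENNReal :=
  letI : Bundle.RiemannianBundle (fun x : M => TangentSpace (𝓡 n) x) := ⟨g.toRiemannianMetric⟩
  Manifold.riemannianEDist (𝓡 n) p q

/-- Metric completeness: every Cauchy sequence for the Riemannian distance converges. -/
def IsCompleteMetric (g : RiemMetric n M) : Prop :=
  ∀ s : ℕ → M,
    (∀ ε : ENNReal, 0 < ε → ∃ N, ∀ i ≥ N, ∀ j ≥ N, riemDist g (s i) (s j) < ε) →
    ∃ p : M, Filter.Tendsto (fun i => riemDist g (s i) p) Filter.atTop (𝓝 0)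

variable (n M) in
/-- Smooth almost complex structures on `M`. -/
structure AlmostComplex where
  J (p : M) : TangentSpace (𝓡 n) p →L[ℝ] TangentSpace (𝓡 n) p
  sq (p : M) (u : TangentSpace (𝓡 n) p) : J p (J p u) = -u
  smooth : ContMDiff (𝓡 n) ((𝓡 n).prod 𝓘(ℝ, Mdl n →L[ℝ] Mdl n)) ∞
    (fun p => Bundle.TotalSpace.mk' (Mdl n →L[ℝ] Mdl n)
      (E := fun p : M => TangentSpace (𝓡 n) p →L[ℝ] TangentSpace (𝓡 n) p) p (J p))

/-- The fundamental form `ω(u, v) = g(J u, v)`. -/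
def fundForm (g : RiemMetric n M) (J : AlmostComplex n M) (p : M) (u v : TangentSpace (𝓡 n) p) : ℝ :=
  g.inner p (J.J p u) v

/-- The coefficients `ωᵢⱼ` of the fundamental form in the preferred chart around `p`. -/
def fundCoeff (g : RiemMetric n M) (J : AlmostComplex n M) (p : M) (i j : Fin n) (y : Mdl n) : ℝ :=
  fundForm g J ((extChartAt (𝓡 n) p).symm y) (coordVec n p y i) (coordVec n p y j)

/-- The Ricci form `ρ(u, v) = Ric(J u, v)`. -/
def ricciForm (g : RiemMetric n M) (J : AlmostComplex n M) (p : M)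
    (u v : TangentSpace (𝓡 n) p) : ℝ :=
  ricci g p (J.J p u) v

end Riemannian

/-- The real differential at `x` of a map to `ℂ²`. -/
def diffC {M : Type*} [TopologicalSpace M] [ChartedSpace (Mdl 4) M] (f : M → ℂ × ℂ) (x : M)
    (u : TangentSpace (𝓡 4) x) : ℂ × ℂ :=
  mfderiv (𝓡 4) 𝓘(ℝ, ℂ × ℂ) f x u

/-- `(g, J)` is a Kähler structure on a `4`-manifold: `J` is orthogonal, comes from holomorphic
coordinates, and the fundamental form is closed. -/
structure IsKahler {M : Type*} [TopologicalSpace M] [ChartedSpace (Mdl 4) M]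
    [IsManifold (𝓡 4) ∞ M] (g : RiemMetric 4 M) (J : AlmostComplex 4 M) : Prop where
  hermitian : ∀ (p : M) (u v : TangentSpace (𝓡 4) p), g.inner p (J.J p u) (J.J p v) = g.inner p u v
  /-- Around each point there are complex coordinates `f : U → ℂ²`, with invertible differential
  that intertwines `J` with the multiplication by the imaginary unit. -/
  integrable : ∀ p : M, ∃ U : Set M, IsOpen U ∧ p ∈ U ∧ ∃ f : M → ℂ × ℂ,
    ContMDiffOn (𝓡 4) 𝓘(ℝ, ℂ × ℂ) ∞ f U ∧
    ∀ x ∈ U, Function.Bijective (diffC f x) ∧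
      ∀ u : TangentSpace (𝓡 4) x, diffC f x (J.J x u) = Complex.I • diffC f x u
  closed : ∀ (p : M) (i j k : Fin 4),
    pderiv i (fundCoeff g J p j k) (extChartAt (𝓡 4) p p)
      + pderiv j (fundCoeff g J p k i) (extChartAt (𝓡 4) p p)
      + pderiv k (fundCoeff g J p i j) (extChartAt (𝓡 4) p p) = 0

/-- The `4`-form `α ∧ α`, for a `2`-form `α` on a vector space. -/
def wedgeSq {V : Type*} (α : V → V → ℝ) (u₁ u₂ u₃ u₄ : V) : ℝ :=
  2 * (α u₁ u₂ * α u₃ u₄ - α u₁ u₃ * α u₂ u₄ + α u₁ u₄ * α u₂ u₃)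

/-- The central curvature of `(g, J)` is the constant `c`, that is `ρ ∧ ρ = c • ω ∧ ω`. -/
def HasCentralCurvature {M : Type*} [TopologicalSpace M] [ChartedSpace (Mdl 4) M]
    [IsManifold (𝓡 4) ∞ M] (g : RiemMetric 4 M) (J : AlmostComplex 4 M) (c : ℝ) : Prop :=
  ∀ (p : M) (u₁ u₂ u₃ u₄ : TangentSpace (𝓡 4) p),
    wedgeSq (ricciForm g J p) u₁ u₂ u₃ u₄ = c * wedgeSq (fundForm g J p) u₁ u₂ u₃ u₄

/-! ## The Heisenberg group and its quotient -/

/-- The Heisenberg group: the element with coordinates `x, y, z` is the unitriangular matrix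
`[[1, x, z], [0, 1, y], [0, 0, 1]]`. -/
@[ext] structure Nil3 where
  x : ℝ
  y : ℝ
  z : ℝ

namespace Nil3

def toMatrix (a : Nil3) : Matrix (Fin 3) (Fin 3) ℝ := !![1, a.x, a.z; 0, 1, a.y; 0, 0, 1]

instance : Mul Nil3 := ⟨fun a b => ⟨a.x + b.x, a.y + b.y, a.z + b.z + a.x * b.y⟩⟩
instance : One Nil3 := ⟨⟨0, 0, 0⟩⟩
instance : Inv Nil3 := ⟨fun a => ⟨-a.x, -a.y, -a.z + a.x * a.y⟩⟩

@[simp] lemma mul_x (a b : Nil3) : (a * b).x = a.x + b.x := rfl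
@[simp] lemma mul_y (a b : Nil3) : (a * b).y = a.y + b.y := rfl
@[simp] lemma mul_z (a b : Nil3) : (a * b).z = a.z + b.z + a.x * b.y := rfl
@[simp] lemma one_x : (1 : Nil3).x = 0 := rfl
@[simp] lemma one_y : (1 : Nil3).y = 0 := rfl
@[simp] lemma one_z : (1 : Nil3).z = 0 := rfl
@[simp] lemma inv_x (a : Nil3) : (a⁻¹).x = -a.x := rfl
@[simp] lemma inv_y (a : Nil3) : (a⁻¹).y = -a.y := rfl
@[simp] lemma inv_z (a : Nil3) : (a⁻¹).z = -a.z + a.x * a.y := rfl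

instance : Group Nil3 := Group.ofLeftAxioms
  (fun a b c => by ext <;> simp <;> ring)
  (fun a => by ext <;> simp)
  (fun a => by ext <;> simp)

theorem toMatrix_mul (a b : Nil3) : (a * b).toMatrix = a.toMatrix * b.toMatrix := by
  ext i j
  fin_cases i <;> fin_cases j <;>
    simp [toMatrix, Matrix.mul_apply, Fin.sum_univ_three] <;> ring

instance : TopologicalSpace Nil3 :=
  TopologicalSpace.induced (fun a => (a.x, a.y, a.z)) inferInstance

lemma continuous_coord : Continuous (fun a : Nil3 => (a.x, a.y, a.z)) := continuous_induced_dom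

end Nil3

/-- The central cyclic subgroup of the elements `(0, 0, 2πn)`, with `n ∈ ℤ`. -/
def Ztilde : Subgroup Nil3 where
  carrier := {a | a.x = 0 ∧ a.y = 0 ∧ ∃ n : ℤ, a.z = 2 * Real.pi * n}
  one_mem' := ⟨rfl, rfl, 0, by simp⟩
  mul_mem' := by
    rintro a b ⟨ha, ha', m, hm⟩ ⟨hb, hb', k, hk⟩
    exact ⟨by simp [ha, hb], by simp [ha', hb'], m + k, by simp [ha, hm, hk]; ring⟩
  inv_mem' := by
    rintro a ⟨ha, ha', m, hm⟩
    exact ⟨by simp [ha], by simp [ha'], -m, by simp [ha, hm]⟩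

lemma mem_Ztilde {a : Nil3} :
    a ∈ Ztilde ↔ a.x = 0 ∧ a.y = 0 ∧ ∃ n : ℤ, a.z = 2 * Real.pi * n := Iff.rfl

instance : Ztilde.Normal where
  conj_mem := by
    rintro a ⟨ha, ha', m, hm⟩ b
    exact ⟨by simp [ha], by simp [ha'], m, by simp [ha, ha', hm]; ring⟩

/-- The group `nil₃ / ℤ`. -/
abbrev HeisQ : Type := Nil3 ⧸ Ztilde

lemma heisQ_eq_iff {a b : Nil3} : (a : HeisQ) = b ↔
    b.x = a.x ∧ b.y = a.y ∧ ∃ n : ℤ, b.z = a.z + 2 * Real.pi * n := by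
  rw [QuotientGroup.eq, mem_Ztilde]
  simp only [Nil3.mul_x, Nil3.mul_y, Nil3.mul_z, Nil3.inv_x, Nil3.inv_y, Nil3.inv_z]
  constructor
  · rintro ⟨h1, h2, n, h3⟩
    have h1' : b.x = a.x := by linarith
    have h2' : b.y = a.y := by linarith
    refine ⟨h1', h2', n, ?_⟩
    rw [h2'] at h3
    linarith
  · rintro ⟨h1, h2, n, h3⟩
    exact ⟨by linarith, by linarith, n, by rw [h2, h3]; ring⟩

namespace HeisQ

/-- The coordinates `x`, `y` and `e^{iz}` on the quotient group. -/
def xyθ : HeisQ → ℝ × ℝ × Circle :=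
  Quotient.lift (fun a : Nil3 => (a.x, a.y, Circle.exp a.z)) (by
    intro a b hab
    obtain ⟨h1, h2, n, h3⟩ := heisQ_eq_iff.1 (Quotient.sound hab : (a : HeisQ) = b)
    simp only [h1, h2, Prod.mk.injEq, true_and]
    rw [Circle.exp_eq_exp]
    exact ⟨-n, by rw [h3]; push_cast; ring⟩)

@[simp] lemma xyθ_mk (a : Nil3) : xyθ (a : HeisQ) = (a.x, a.y, Circle.exp a.z) := rfl

lemma continuous_xyθ : Continuous xyθ := by
  refine Continuous.quotient_lift ?_ _
  have h := Nil3.continuous_coord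
  exact (continuous_fst.comp h).prodMk ((continuous_fst.comp (continuous_snd.comp h)).prodMk
    (Circle.exp.continuous.comp (continuous_snd.comp (continuous_snd.comp h))))

lemma center_x_y {k : HeisQ} (hk : k ∈ Subgroup.center HeisQ) : (xyθ k).1 = 0 ∧ (xyθ k).2.1 = 0 := by
  induction k using QuotientGroup.induction_on with
  | H a =>
    rw [Subgroup.mem_center_iff] at hk
    have key : ∀ s t : ℝ, ∃ n : ℤ, s * a.y - a.x * t = 2 * Real.pi * n := by
      intro s t
      have h := hk ((⟨s, t, 0⟩ : Nil3) : HeisQ)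
      rw [← QuotientGroup.mk_mul, ← QuotientGroup.mk_mul, heisQ_eq_iff] at h
      obtain ⟨-, -, n, h3⟩ := h
      refine ⟨-n, ?_⟩
      simp only [Nil3.mul_z] at h3
      push_cast
      linarith
    have npi : ∀ n : ℤ, (1 : ℝ) ≠ 2 * Real.pi * n := by
      intro n hn
      have hpi := Real.pi_gt_three
      rcases lt_trichotomy n 0 with h | h | h
      · have : (n : ℝ) < 0 := by exact_mod_cast h
        nlinarith
      · simp [h] at hn
      · have : (1 : ℝ) ≤ n := by exact_mod_cast h
        nlinarith
    constructor
    · by_contra h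
      obtain ⟨n, hn⟩ := key 0 (-(a.x)⁻¹)
      have h' : a.x ≠ 0 := h
      refine npi n ?_
      rw [← hn]
      field_simp
      simp
    · by_contra h
      obtain ⟨n, hn⟩ := key (a.y)⁻¹ 0
      have h' : a.y ≠ 0 := h
      refine npi n ?_
      rw [← hn]
      field_simp
      simp

lemma xyθ_mul {g k : HeisQ} (hk : k ∈ Subgroup.center HeisQ) :
    xyθ (g * k) = ((xyθ g).1, (xyθ g).2.1, (xyθ g).2.2 * (xyθ k).2.2) := by
  have h := center_x_y hk
  induction g using QuotientGroup.induction_on with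
  | H a =>
    induction k using QuotientGroup.induction_on with
    | H b =>
      simp only [xyθ_mk] at h
      change xyθ ((a * b : Nil3) : HeisQ) = _
      simp only [xyθ_mk, Nil3.mul_x, Nil3.mul_y, Nil3.mul_z, h.1, h.2, add_zero, mul_zero,
        Circle.exp_add]

/-- The homomorphism `(0, 0, z) ↦ e^{iz}` from the center to `SO(2)`, the unit circle of `ℂ`. -/
def centerRot : Subgroup.center HeisQ →* Circle where
  toFun k := (xyθ k).2.2
  map_one' := by
    change Circle.exp 0 = 1
    exact Circle.exp_zero
  map_mul' k l := by
    change (xyθ ((k : HeisQ) * l)).2.2 = _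
    rw [xyθ_mul l.2]

lemma mk_mem_center (z : ℝ) : ((⟨0, 0, z⟩ : Nil3) : HeisQ) ∈ Subgroup.center HeisQ := by
  rw [Subgroup.mem_center_iff]
  intro g
  induction g using QuotientGroup.induction_on with
  | H a =>
    rw [← QuotientGroup.mk_mul, ← QuotientGroup.mk_mul]
    congr 1
    ext <;> simp
    ring

lemma exists_of_mem_center {k : HeisQ} (hk : k ∈ Subgroup.center HeisQ) :
    ∃ z : ℝ, k = ((⟨0, 0, z⟩ : Nil3) : HeisQ) := by
  have h := center_x_y hk
  induction k using QuotientGroup.induction_on with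
  | H a =>
    simp only [xyθ_mk] at h
    refine ⟨a.z, ?_⟩
    congr 1
    ext
    · exact h.1
    · exact h.2
    · rfl

/-- The center is isomorphic to `SO(2)`. -/
theorem centerRot_bijective : Function.Bijective centerRot := by
  constructor
  · rintro ⟨k, hk⟩ ⟨l, hl⟩ h
    obtain ⟨s, rfl⟩ := exists_of_mem_center hk
    obtain ⟨t, rfl⟩ := exists_of_mem_center hl
    change Circle.exp s = Circle.exp t at h
    rw [Circle.exp_eq_exp] at h
    obtain ⟨m, hm⟩ := h
    simp only [Subtype.mk.injEq]
    rw [heisQ_eq_iff]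
    exact ⟨rfl, rfl, -m, by simp only [hm]; push_cast; ring⟩
  · intro c
    obtain ⟨t, ht⟩ := Circle.exp_surjective c
    exact ⟨⟨_, mk_mem_center t⟩, ht⟩

end HeisQ

/-! ## The bundle `G ×_{SO(2)} ℝ²` -/

/-- The equivalence relation `(g, v) ~ (g k⁻¹, k v)`, where `k` ranges over the center of the group
and acts on `ℝ² = ℂ` by rotations. -/
def bundleSetoid : Setoid (HeisQ × ℂ) where
  r a b := ∃ k : Subgroup.center HeisQ,
    b.1 = a.1 * (k : HeisQ)⁻¹ ∧ b.2 = (HeisQ.centerRot k : ℂ) * a.2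
  iseqv := by
    refine ⟨fun a => ⟨1, by simp⟩, ?_, ?_⟩
    · rintro a b ⟨k, h1, h2⟩
      refine ⟨k⁻¹, by simp [h1], ?_⟩
      rw [h2, ← mul_assoc, ← Circle.coe_mul, ← map_mul]
      simp
    · rintro a b c ⟨k, h1, h2⟩ ⟨l, h3, h4⟩
      refine ⟨l * k, by simp [h3, h1, mul_assoc], ?_⟩
      rw [h4, h2, map_mul, Circle.coe_mul, mul_assoc]

/-- The homogeneous bundle `G ×_{SO(2)} ℝ²` with `G = nil₃ / ℤ`. -/
def HeisBundle : Type := Quotient bundleSetoid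

namespace HeisBundle

instance : TopologicalSpace HeisBundle := inferInstanceAs (TopologicalSpace (Quotient bundleSetoid))

/-- The class `[g, v]`. -/
def mk (g : HeisQ) (v : ℂ) : HeisBundle := Quotient.mk bundleSetoid (g, v)

lemma continuous_mk : Continuous (fun a : HeisQ × ℂ => mk a.1 a.2) := continuous_quotient_mk'

/-- The global coordinates `[(x, y, z), v] ↦ (x, y, e^{iz} v)`. -/
def coord : HeisBundle → Mdl 4 :=
  Quotient.lift (fun a : HeisQ × ℂ => !₂[(HeisQ.xyθ a.1).1, (HeisQ.xyθ a.1).2.1,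
    (((HeisQ.xyθ a.1).2.2 : ℂ) * a.2).re, (((HeisQ.xyθ a.1).2.2 : ℂ) * a.2).im]) (by
    rintro ⟨g, v⟩ ⟨g', v'⟩ ⟨k, h1, h2⟩
    simp only at h1 h2
    have hg : g = g' * (k : HeisQ) := by rw [h1, inv_mul_cancel_right]
    have hk := HeisQ.xyθ_mul (g := g') k.2
    rw [← hg] at hk
    have hc : ((HeisQ.xyθ g).2.2 : ℂ) * v = ((HeisQ.xyθ g').2.2 : ℂ) * v' := by
      rw [hk, h2]
      change (((HeisQ.xyθ g').2.2 * HeisQ.centerRot k : Circle) : ℂ) * v = _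
      rw [Circle.coe_mul, mul_assoc]
    simp only [hc]
    rw [hk])

@[simp] lemma coord_mk (a : Nil3) (v : ℂ) : coord (mk a v) =
    !₂[a.x, a.y, ((Circle.exp a.z : ℂ) * v).re, ((Circle.exp a.z : ℂ) * v).im] := rfl

/-- The inverse of `coord`. -/
def ofCoord (e : Mdl 4) : HeisBundle := mk ((⟨e 0, e 1, 0⟩ : Nil3) : HeisQ) ⟨e 2, e 3⟩

lemma mk_eq (x y z : ℝ) (v : ℂ) : mk ((⟨x, y, z⟩ : Nil3) : HeisQ) v =
    mk ((⟨x, y, 0⟩ : Nil3) : HeisQ) (Circle.exp z * v) := by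
  refine Quotient.sound ⟨⟨_, HeisQ.mk_mem_center z⟩, ?_, rfl⟩
  change ((⟨x, y, 0⟩ : Nil3) : HeisQ) = _
  rw [eq_mul_inv_iff_mul_eq, ← QuotientGroup.mk_mul]
  congr 1
  ext <;> simp

lemma ofCoord_coord (p : HeisBundle) : ofCoord (coord p) = p := by
  induction p using Quotient.inductionOn with
  | h a =>
    obtain ⟨g, v⟩ := a
    induction g using QuotientGroup.induction_on with
    | H a => exact (mk_eq a.x a.y a.z v).symm

lemma coord_ofCoord (e : Mdl 4) : coord (ofCoord e) = e := by
  rw [ofCoord, coord_mk]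
  ext i
  fin_cases i <;> simp

lemma continuous_coord : Continuous coord := by
  refine Continuous.quotient_lift ?_ _
  have h : Continuous fun a : HeisQ × ℂ => HeisQ.xyθ a.1 :=
    HeisQ.continuous_xyθ.comp continuous_fst
  refine (PiLp.continuous_toLp 2 _).comp (continuous_pi fun i => ?_)
  have h2 : Continuous fun a : HeisQ × ℂ => ((HeisQ.xyθ a.1).2.2 : ℂ) * a.2 :=
    (continuous_subtype_val.comp (continuous_snd.comp (continuous_snd.comp h))).mul continuous_snd
  fin_cases i
  · exact continuous_fst.comp h
  · exact continuous_fst.comp (continuous_snd.comp h)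
  · exact Complex.continuous_re.comp h2
  · exact Complex.continuous_im.comp h2

lemma continuous_ofCoord : Continuous ofCoord := by
  have h1 : Continuous fun e : Mdl 4 => (⟨e 0, e 1, 0⟩ : Nil3) := by
    refine continuous_induced_rng.2 ?_
    change Continuous fun e : Mdl 4 => (e 0, e 1, (0 : ℝ))
    fun_prop
  have h2 : Continuous fun e : Mdl 4 => (⟨e 2, e 3⟩ : ℂ) := by
    have : (fun e : Mdl 4 => (⟨e 2, e 3⟩ : ℂ)) =
        fun e => Complex.equivRealProdCLM.symm (e 2, e 3) := rfl
    rw [this]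
    fun_prop
  exact continuous_mk.comp ((continuous_quotient_mk'.comp h1).prodMk h2)

/-- The global chart. -/
def chart : HeisBundle ≃ₜ Mdl 4 where
  toFun := coord
  invFun := ofCoord
  left_inv := ofCoord_coord
  right_inv := coord_ofCoord
  continuous_toFun := continuous_coord
  continuous_invFun := continuous_ofCoord

instance : Nonempty HeisBundle := ⟨mk 1 0⟩

instance : ChartedSpace (Mdl 4) HeisBundle :=
  chart.isOpenEmbedding.singletonChartedSpace

instance : IsManifold (𝓡 4) ∞ HeisBundle :=
  chart.isOpenEmbedding.isManifold_singleton

lemma contMDiff_coord : ContMDiff (𝓡 4) (𝓡 4) ∞ coord :=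
  contMDiff_isOpenEmbedding chart.isOpenEmbedding

lemma contMDiff_ofCoord : ContMDiff (𝓡 4) (𝓡 4) ∞ ofCoord := by
  rw [contMDiff_iff]
  refine ⟨continuous_ofCoord, fun p q => ?_⟩
  have : (fun e : Mdl 4 => coord (ofCoord e)) = id := funext coord_ofCoord
  refine ContDiff.contDiffOn ?_
  change ContDiff ℝ ∞ (fun e : Mdl 4 => coord (ofCoord e))
  rw [this]
  exact contDiff_id

/-- The projection `nil₃ × ℝ² → G ×_{SO(2)} ℝ²`. -/
def proj (c : ℝ × ℝ × ℝ × ℂ) : HeisBundle := mk ((⟨c.1, c.2.1, c.2.2.1⟩ : Nil3) : HeisQ) c.2.2.2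

lemma contMDiff_proj : ContMDiff 𝓘(ℝ, ℝ × ℝ × ℝ × ℂ) (𝓡 4) ∞ proj := by
  have h : proj = fun c => ofCoord (coord (proj c)) := by
    funext c
    rw [ofCoord_coord]
  rw [h]
  refine contMDiff_ofCoord.comp (ContDiff.contMDiff ?_)
  change ContDiff ℝ ∞ fun c : ℝ × ℝ × ℝ × ℂ => (!₂[c.1, c.2.1,
    ((Circle.exp c.2.2.1 : ℂ) * c.2.2.2).re, ((Circle.exp c.2.2.1 : ℂ) * c.2.2.2).im] : Mdl 4)
  have h2 : ContDiff ℝ ∞ fun c : ℝ × ℝ × ℝ × ℂ => (Circle.exp c.2.2.1 : ℂ) * c.2.2.2 := by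
    simp only [Circle.coe_exp]
    have h3 : ContDiff ℝ ∞ fun c : ℝ × ℝ × ℝ × ℂ => ((c.2.2.1 : ℝ) : ℂ) :=
      Complex.ofRealCLM.contDiff.comp (by fun_prop)
    exact ((h3.mul contDiff_const).cexp).mul (by fun_prop)
  rw [contDiff_euclidean]
  intro i
  fin_cases i
  · exact contDiff_fst
  · exact contDiff_fst.comp contDiff_snd
  · exact Complex.reCLM.contDiff.comp h2
  · exact Complex.imCLM.contDiff.comp h2

/-- The smooth structure is the quotient one: a function on the bundle is smooth if and only if
its pullback to `nil₃ × ℝ²` is. -/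
theorem contMDiff_iff_proj {F : Type*} [NormedAddCommGroup F] [NormedSpace ℝ F]
    (f : HeisBundle → F) :
    ContMDiff (𝓡 4) 𝓘(ℝ, F) ∞ f ↔ ContDiff ℝ ∞ (fun c => f (proj c)) := by
  constructor
  · intro h
    exact (h.comp contMDiff_proj).contDiff
  · intro h
    have hs : ContDiff ℝ ∞ fun e : Mdl 4 => (e 0, e 1, (0 : ℝ),
        Complex.equivRealProdCLM.symm (e 2, e 3)) := by
      have h2 : ContDiff ℝ ∞ fun e : Mdl 4 => Complex.equivRealProdCLM.symm (e 2, e 3) :=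
        Complex.equivRealProdCLM.symm.contDiff.comp (by fun_prop)
      fun_prop
    have h3 := (h.comp hs).contMDiff.comp contMDiff_coord
    refine h3.congr fun p => ?_
    conv_lhs => rw [← ofCoord_coord p]
    rfl

/-- The regular part: `(x, y, z, q) ↦ [(x, y, z), (e^q, 0)]`. -/
def regPt (a : Mdl 4) : HeisBundle :=
  mk ((⟨a 0, a 1, a 2⟩ : Nil3) : HeisQ) (Real.exp (a 3) : ℝ)

/-- The regular part is the complement of the zero section (the singular orbit). -/
theorem range_regPt : Set.range regPt = (Set.range fun g : HeisQ => mk g 0)ᶜ := by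
  ext p
  constructor
  · rintro ⟨a, rfl⟩ ⟨g, hg⟩
    obtain ⟨k, -, h2⟩ := Quotient.exact hg
    simp at h2
  · intro hp
    obtain ⟨⟨g, v⟩, rfl⟩ := Quotient.exists_rep p
    induction g using QuotientGroup.induction_on with
    | H a =>
      have hv : v ≠ 0 := by
        rintro rfl
        exact hp ⟨_, rfl⟩
      refine ⟨!₂[a.x, a.y, a.z + v.arg, Real.log ‖v‖], ?_⟩
      change mk ((⟨a.x, a.y, a.z + v.arg⟩ : Nil3) : HeisQ) ((Real.exp (Real.log ‖v‖) : ℝ) : ℂ)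
        = mk ((⟨a.x, a.y, a.z⟩ : Nil3) : HeisQ) v
      rw [mk_eq, mk_eq a.x a.y a.z, Real.exp_log (norm_pos_iff.2 hv), Circle.exp_add,
        Circle.coe_mul, mul_assoc]
      congr 2
      rw [Circle.coe_exp, mul_comm]
      exact Complex.norm_mul_exp_arg_mul_I v

/-- The differential of `regPt`. -/
def dReg (a u : Mdl 4) : TangentSpace (𝓡 4) (regPt a) := mfderiv (𝓡 4) (𝓡 4) regPt a u

end HeisBundle

/-! ## The forms and the metric, in the coordinates `(x, y, z, q)` -/

/-- The left-invariant form `σ₁ = dx`. -/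
def sig₁ (_a u : Mdl 4) : ℝ := u 0
/-- The left-invariant form `σ₂ = dy`. -/
def sig₂ (_a u : Mdl 4) : ℝ := u 1
/-- The left-invariant form `σ₃ = x dy - dz`. -/
def sig₃ (a u : Mdl 4) : ℝ := a 0 * u 1 - u 2
/-- The form `dq`. -/
def dq (_a u : Mdl 4) : ℝ := u 3

/-- The left-invariant field `X₁ = ∂ₓ`. -/
def fieldX₁ (_a : Mdl 4) : Mdl 4 := !₂[1, 0, 0, 0]
/-- The left-invariant field `X₂ = ∂_y + x ∂_z`. -/
def fieldX₂ (a : Mdl 4) : Mdl 4 := !₂[0, 1, a 0, 0]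
/-- The left-invariant field `X₃ = -∂_z`. -/
def fieldX₃ (_a : Mdl 4) : Mdl 4 := !₂[0, 0, -1, 0]
/-- The field `∂_q`. -/
def fieldQ (_a : Mdl 4) : Mdl 4 := !₂[0, 0, 0, 1]

/-- The coefficient `(e^{2q} + c₁²)^{1/2}`. -/
def phi (c₁ q : ℝ) : ℝ := Real.sqrt (Real.exp (2 * q) + c₁ ^ 2)

/-- The metric
`e^{2q} (e^{2q} + c₁²)^{-1/2} (dq² + σ₃²) + (e^{2q} + c₁²)^{1/2} (σ₁² + σ₂²)`. -/
def biaxial (c₁ : ℝ) (a u v : Mdl 4) : ℝ :=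
  Real.exp (2 * a 3) / phi c₁ (a 3) * (dq a u * dq a v + sig₃ a u * sig₃ a v)
    + phi c₁ (a 3) * (sig₁ a u * sig₁ a v + sig₂ a u * sig₂ a v)

/-- The form
`e^{2q} (e^{2q} + c₁²)^{-1/2} dq ∧ σ₃ + (e^{2q} + c₁²)^{1/2} σ₁ ∧ σ₂`. -/
def biaxialForm (c₁ : ℝ) (a u v : Mdl 4) : ℝ :=
  Real.exp (2 * a 3) / phi c₁ (a 3) * (dq a u * sig₃ a v - dq a v * sig₃ a u)
    + phi c₁ (a 3) * (sig₁ a u * sig₂ a v - sig₁ a v * sig₂ a u)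

end

/-! The bundle has global coordinates `(x, y, u, v)` with `u + iv = e^{q + iz}` off the zero
section. Put `φ = (u² + v² + c²)^{1/2}`, `α = du + x v dy` and `β = dv - x u dy`. Then `α + iβ = (u
+ iv)(dq - iσ₃)`, so the given metric is `φ (dx² + dy²) + φ⁻¹ (α² + β²)`. Since `c > 0`, `φ` is
smooth and positive everywhere, and this expression is the extension across `u = v = 0`. The complex
structure extends likewise: it rotates the pairs `(dx, dy)` and `(α, β)` of the coframe.

The Kähler property: on the regular part `ω = d(φ σ₃)`, because `dφ/dq = e^{2q}/φ` and `dσ₃ = σ₁ ∧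
σ₂`; and `x + iy`, `(u - iv) e^{-x²/2}` are holomorphic coordinates.

The curvature: the coframe has determinant one and the powers of `φ` cancel, so the volume is `dx dy
du dv`, which has density `e^{x²}` in the holomorphic coordinates. Hence `ρ = -i ∂∂̄ x² = -dx ∧ dy`
and `Ric = -(dx² + dy²)`: nonzero, of rank two, and with decomposable Ricci form. The formal proof
gets this tensor from the Christoffel symbols (`ricciCoeff_coeffMatrix`), by exact algebra in `x, u,
v, φ, φ⁻¹`.

Completeness: the functions `√c x`, `√c y` and `√φ` have differentials of norm at most one, hence
are 1-Lipschitz (`edist_le_riemDist`), and together they are proper. A Cauchy sequence therefore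
stays in a compact set, and a convergent subsequence gives its limit. -/

noncomputable section

namespace HeisBundle

/-! ### Calculus in the single global chart -/

lemma coe_extChartAt (p : HeisBundle) : (extChartAt (𝓡 4) p : HeisBundle → Mdl 4) = coord := rfl

lemma coe_extChartAt_symm (p : HeisBundle) :
    ((extChartAt (𝓡 4) p).symm : Mdl 4 → HeisBundle) = ofCoord := by
  funext e
  have h : coord ((extChartAt (𝓡 4) p).symm e) = e := by
    rw [← coe_extChartAt p]
    refine (extChartAt (𝓡 4) p).right_inv ?_
    rw [extChartAt_target]
    have : (chartAt (Mdl 4) p).target = Set.univ :=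
      (chart.isOpenEmbedding.toOpenPartialHomeomorph_target _).trans chart.surjective.range_eq
    rw [this, modelWithCornersSelf_coe, Set.range_id, Set.preimage_univ, Set.univ_inter]
    exact Set.mem_univ e
  rw [← ofCoord_coord ((extChartAt (𝓡 4) p).symm e), h]

lemma mfderiv_eq_fderiv_comp_ofCoord {F : Type*} [NormedAddCommGroup F] [NormedSpace ℝ F]
    {f : HeisBundle → F} (p : HeisBundle) (hf : MDifferentiableAt (𝓡 4) 𝓘(ℝ, F) f p) :
    mfderiv (𝓡 4) 𝓘(ℝ, F) f p = (fderiv ℝ (fun e => f (ofCoord e)) (coord p) : Mdl 4 →L[ℝ] F) := by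
  have h : writtenInExtChartAt (𝓡 4) 𝓘(ℝ, F) p f = fun e => f (ofCoord e) := by
    funext e
    simp only [writtenInExtChartAt, coe_extChartAt_symm, extChartAt_model_space_eq_id]
    rfl
  refine hf.mfderiv.trans ?_
  rw [h, ModelWithCorners.range_eq_univ, fderivWithin_univ]
  rfl

lemma mfderiv_coord (p : HeisBundle) :
    mfderiv (𝓡 4) (𝓡 4) coord p = ContinuousLinearMap.id ℝ (Mdl 4) := by
  refine (mfderiv_eq_fderiv_comp_ofCoord p
    (contMDiff_coord.mdifferentiable (by simp) p)).trans ?_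
  have : (fun e => coord (ofCoord e)) = id := funext coord_ofCoord
  rw [this, fderiv_id]

lemma mfderiv_eq_fderiv_coord_comp {F : Type*} [NormedAddCommGroup F] [NormedSpace ℝ F]
    {f : F → HeisBundle} (a : F) (hf : MDifferentiableAt 𝓘(ℝ, F) (𝓡 4) f a) :
    mfderiv 𝓘(ℝ, F) (𝓡 4) f a = (fderiv ℝ (fun e => coord (f e)) a : F →L[ℝ] Mdl 4) := by
  refine hf.mfderiv.trans ?_
  rw [ModelWithCorners.range_eq_univ, fderivWithin_univ]
  rfl

lemma mfderiv_ofCoord (e : Mdl 4) :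
    mfderiv (𝓡 4) (𝓡 4) ofCoord e = ContinuousLinearMap.id ℝ (Mdl 4) := by
  refine (mfderiv_eq_fderiv_coord_comp e
    (contMDiff_ofCoord.mdifferentiable (by simp) e)).trans ?_
  have : (fun e => coord (ofCoord e)) = id := funext coord_ofCoord
  rw [this, fderiv_id]

lemma coordVec_eq (p : HeisBundle) (y : Mdl 4) (i : Fin 4) :
    coordVec 4 p y i = (EuclideanSpace.single i 1 : Mdl 4) := by
  -- The tangent space depends on the base point, so rewriting the inverse chart in place would be
  -- ill-typed; generalizing it to a variable `f` allows a substitution.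
  have h : ∀ f : Mdl 4 → HeisBundle, f = ofCoord →
      (mfderiv (𝓡 4) (𝓡 4) f y (EuclideanSpace.single i 1) : Mdl 4) = EuclideanSpace.single i 1 := by
    rintro f rfl
    exact congrArg (fun L : Mdl 4 →L[ℝ] Mdl 4 => L (EuclideanSpace.single i 1)) (mfderiv_ofCoord y)
  exact h _ (coe_extChartAt_symm p)

lemma vecCoord_eq (p : HeisBundle) (u : Mdl 4) : vecCoord (n := 4) p u = u :=
  congrArg (fun L : Mdl 4 →L[ℝ] Mdl 4 => L u) (mfderiv_coord p)

/-- The atlas has one chart, so the charts at `p` and `q` agree definitionally and the transition is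
that of a chart with itself. Every trivialization of the tangent bundle is then the identity, and
smoothness of a tensor reduces to smoothness of its components. -/
lemma tangentBundleCore_coordChange_eq_id (p q r : HeisBundle) :
    (tangentBundleCore (𝓡 4) HeisBundle).coordChange (achart (Mdl 4) p) (achart (Mdl 4) q) r =
      ContinuousLinearMap.id ℝ (Mdl 4) := by
  ext1 w
  exact (tangentBundleCore (𝓡 4) HeisBundle).coordChange_self (achart (Mdl 4) p) r
    (mem_chart_source (Mdl 4) r) w

lemma symmL_trivializationAt (p q : HeisBundle) :
    (trivializationAt (Mdl 4) (TangentSpace (𝓡 4) : HeisBundle → Type _) p).symmL ℝ q =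
      ContinuousLinearMap.id ℝ (Mdl 4) :=
  (TangentBundle.symmL_trivializationAt_eq_core (mem_chart_source (Mdl 4) q)).trans
    (tangentBundleCore_coordChange_eq_id p q q)

lemma continuousLinearMapAt_trivializationAt (p q : HeisBundle) :
    (trivializationAt (Mdl 4) (TangentSpace (𝓡 4) : HeisBundle → Type _) p).continuousLinearMapAt
      ℝ q = ContinuousLinearMap.id ℝ (Mdl 4) :=
  (TangentBundle.continuousLinearMapAt_trivializationAt_eq_core (mem_chart_source (Mdl 4) q)).trans
    (tangentBundleCore_coordChange_eq_id q p q)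

lemma contMDiff_endomorphism {A : Mdl 4 → Mdl 4 →L[ℝ] Mdl 4} (hA : ContDiff ℝ ∞ A) :
    ContMDiff (𝓡 4) ((𝓡 4).prod 𝓘(ℝ, Mdl 4 →L[ℝ] Mdl 4)) ∞
    (fun p : HeisBundle => Bundle.TotalSpace.mk' (Mdl 4 →L[ℝ] Mdl 4)
      (E := fun p : HeisBundle => TangentSpace (𝓡 4) p →L[ℝ] TangentSpace (𝓡 4) p) p
      (A (coord p))) := by
  intro p
  rw [contMDiffAt_hom_bundle]
  refine ⟨contMDiffAt_id, ?_⟩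
  refine ((hA.contMDiff.comp contMDiff_coord).contMDiffAt (x := p)).congr_of_eventuallyEq ?_
  filter_upwards with q
  refine ContinuousLinearMap.ext fun w => ?_
  have h1 := congrArg (fun L : Mdl 4 →L[ℝ] Mdl 4 => L w) (symmL_trivializationAt p q)
  have h2 := fun z : Mdl 4 => congrArg (fun L : Mdl 4 →L[ℝ] Mdl 4 => L z)
    (continuousLinearMapAt_trivializationAt p q)
  exact (h2 _).trans (congrArg (A (coord q)) h1)

lemma contMDiff_bilinear {B : Mdl 4 → Mdl 4 →L[ℝ] Mdl 4 →L[ℝ] ℝ} (hB : ContDiff ℝ ∞ B) :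
    ContMDiff (𝓡 4) ((𝓡 4).prod 𝓘(ℝ, Mdl 4 →L[ℝ] Mdl 4 →L[ℝ] ℝ)) ∞
    (fun p : HeisBundle => Bundle.TotalSpace.mk' (Mdl 4 →L[ℝ] Mdl 4 →L[ℝ] ℝ)
      (E := fun p : HeisBundle => TangentSpace (𝓡 4) p →L[ℝ] TangentSpace (𝓡 4) p →L[ℝ] ℝ) p
      (B (coord p))) := by
  intro p
  rw [contMDiffAt_hom_bundle]
  refine ⟨contMDiffAt_id, ?_⟩
  refine ((hB.contMDiff.comp contMDiff_coord).contMDiffAt (x := p)).congr_of_eventuallyEq ?_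
  filter_upwards with q
  refine ContinuousLinearMap.ext fun w => ContinuousLinearMap.ext fun z => ?_
  have h := fun w : Mdl 4 =>
    congrArg (fun L : Mdl 4 →L[ℝ] Mdl 4 => L w) (symmL_trivializationAt p q)
  refine (inCoordinates_apply_eq₂ (E₃ := fun _ : HeisBundle => ℝ) (F₃ := ℝ)
    (mem_chart_source (Mdl 4) q) (mem_chart_source (Mdl 4) q) (Set.mem_univ _)).trans ?_
  rw [Bundle.Trivialization.coe_linearMapAt_of_mem _ (Set.mem_univ _)]
  have h' : ∀ w : Mdl 4, ((trivializationAt (Mdl 4) (TangentSpace (𝓡 4) : HeisBundle → Type _)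
      p).symm q w : Mdl 4) = w := fun w =>
    (Bundle.Trivialization.symmL_apply (R := ℝ) (b := q) _ (mem_chart_source (Mdl 4) q) w).symm.trans
      (h w)
  change B (coord q) ((trivializationAt (Mdl 4) (TangentSpace (𝓡 4) : HeisBundle → Type _)
    p).symm q w : Mdl 4) ((trivializationAt (Mdl 4) (TangentSpace (𝓡 4) : HeisBundle → Type _)
    p).symm q z : Mdl 4) = B (coord q) w z
  rw [h', h']

/-! ### Differentiation of polynomials in `x, u, v, φ, φ⁻¹` -/

open MvPolynomial (eval X C mkDerivation mkDerivation_X)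

/-- The function `(u² + v² + c²)^{1/2}` of the global coordinates `(x, y, u, v)`. -/
def rad (c : ℝ) (e : Mdl 4) : ℝ := Real.sqrt (e 2 ^ 2 + e 3 ^ 2 + c ^ 2)

lemma rad_pos {c : ℝ} (hc : 0 < c) (e : Mdl 4) : 0 < rad c e := Real.sqrt_pos.2 (by positivity)

lemma rad_sq (c : ℝ) (e : Mdl 4) : rad c e ^ 2 = e 2 ^ 2 + e 3 ^ 2 + c ^ 2 :=
  Real.sq_sqrt (by positivity)

lemma contDiff_rad {c : ℝ} (hc : 0 < c) : ContDiff ℝ ∞ (rad c) :=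
  ContDiff.sqrt (by fun_prop) fun e => by positivity

/-- The functions `x, u, v, φ, φ⁻¹` in which the tensors of this section are polynomial. -/
def gens (c : ℝ) (e : Mdl 4) : Fin 5 → ℝ := ![e 0, e 2, e 3, rad c e, (rad c e)⁻¹]

/-- A polynomial in `x, u, v, φ, φ⁻¹` as a function of the coordinates. -/
def polyFun (c : ℝ) (p : MvPolynomial (Fin 5) ℝ) (e : Mdl 4) : ℝ := eval (gens c e) p

/-- The partial derivatives, on polynomials in `x, u, v, φ, φ⁻¹`. -/
def polyDeriv (i : Fin 4) : Derivation ℝ (MvPolynomial (Fin 5) ℝ) (MvPolynomial (Fin 5) ℝ) :=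
  mkDerivation ℝ (![![1, 0, 0, 0, 0], ![0, 0, 0, 0, 0], ![0, 1, 0, X 1 * X 4, -(X 1 * X 4 ^ 3)],
    ![0, 0, 1, X 2 * X 4, -(X 2 * X 4 ^ 3)]] i)

lemma contDiff_gens {c : ℝ} (hc : 0 < c) (j : Fin 5) : ContDiff ℝ ∞ fun e => gens c e j := by
  have h := contDiff_rad hc
  fin_cases j
  · change ContDiff ℝ ∞ fun e : Mdl 4 => e 0
    fun_prop
  · change ContDiff ℝ ∞ fun e : Mdl 4 => e 2
    fun_prop
  · change ContDiff ℝ ∞ fun e : Mdl 4 => e 3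
    fun_prop
  · exact h
  · exact h.inv fun e => (rad_pos hc e).ne'

lemma contDiff_polyFun {c : ℝ} (hc : 0 < c) (p : MvPolynomial (Fin 5) ℝ) :
    ContDiff ℝ ∞ (polyFun c p) := by
  induction p using MvPolynomial.induction_on with
  | C a =>
    have : polyFun c (C a) = fun _ => a := by funext e; simp [polyFun]
    rw [this]
    exact contDiff_const
  | add p q hp hq =>
    have : polyFun c (p + q) = polyFun c p + polyFun c q := by funext e; simp [polyFun]
    rw [this]
    exact hp.add hq
  | mul_X p j hp =>
    have : polyFun c (p * X j) = polyFun c p * fun e => gens c e j := by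
      funext e; simp [polyFun]
    rw [this]
    exact hp.mul (contDiff_gens hc j)

lemma differentiable_polyFun {c : ℝ} (hc : 0 < c) (p : MvPolynomial (Fin 5) ℝ) :
    Differentiable ℝ (polyFun c p) :=
  (contDiff_polyFun hc p).differentiable (by simp)

lemma hasFDerivAt_rad {c : ℝ} (hc : 0 < c) (e : Mdl 4) :
    HasFDerivAt (rad c) ((rad c e)⁻¹ • (e 2 • EuclideanSpace.proj (𝕜 := ℝ) (2 : Fin 4) +
      e 3 • EuclideanSpace.proj (𝕜 := ℝ) (3 : Fin 4)) : Mdl 4 →L[ℝ] ℝ) e := by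
  have h2 : HasFDerivAt (fun e : Mdl 4 => e 2) (EuclideanSpace.proj (𝕜 := ℝ) (2 : Fin 4)) e :=
    (EuclideanSpace.proj (𝕜 := ℝ) (2 : Fin 4)).hasFDerivAt
  have h3 : HasFDerivAt (fun e : Mdl 4 => e 3) (EuclideanSpace.proj (𝕜 := ℝ) (3 : Fin 4)) e :=
    (EuclideanSpace.proj (𝕜 := ℝ) (3 : Fin 4)).hasFDerivAt
  have h : HasFDerivAt (fun e : Mdl 4 => e 2 ^ 2 + e 3 ^ 2 + c ^ 2) _ e :=
    ((h2.pow 2).add (h3.pow 2)).add_const (c ^ 2)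
  have hr := (rad_pos hc e).ne'
  refine (h.sqrt (by positivity)).congr_fderiv ?_
  change (1 / (2 * rad c e)) • _ = _
  ext w
  simp
  field_simp

lemma pderiv_coord (i j : Fin 4) (e : Mdl 4) :
    pderiv i (fun e => e j) e = if i = j then 1 else 0 := by
  have h : HasFDerivAt (fun e : Mdl 4 => e j) (EuclideanSpace.proj (𝕜 := ℝ) j) e :=
    (EuclideanSpace.proj (𝕜 := ℝ) j).hasFDerivAt
  rw [pderiv, h.fderiv]
  simp [eq_comm]

lemma pderiv_rad {c : ℝ} (hc : 0 < c) (i : Fin 4) (e : Mdl 4) :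
    pderiv i (rad c) e = (rad c e)⁻¹ * (if i = 2 then e 2 else if i = 3 then e 3 else 0) := by
  rw [pderiv, (hasFDerivAt_rad hc e).fderiv]
  fin_cases i <;> simp

lemma pderiv_inv_rad {c : ℝ} (hc : 0 < c) (i : Fin 4) (e : Mdl 4) :
    pderiv i (fun e => (rad c e)⁻¹) e =
      -((rad c e)⁻¹ ^ 3 * (if i = 2 then e 2 else if i = 3 then e 3 else 0)) := by
  have hr := (rad_pos hc e).ne'
  have h := (hasDerivAt_inv hr).comp_hasFDerivAt e (hasFDerivAt_rad hc e)
  change fderiv ℝ (Inv.inv ∘ rad c) e _ = _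
  rw [h.fderiv]
  fin_cases i <;> simp <;> field_simp

lemma pderiv_gens {c : ℝ} (hc : 0 < c) (i : Fin 4) (j : Fin 5) (e : Mdl 4) :
    pderiv i (fun e => gens c e j) e = polyFun c (polyDeriv i (X j)) e := by
  fin_cases j
  · refine (pderiv_coord i 0 e).trans ?_
    fin_cases i <;> simp [polyDeriv, mkDerivation_X, polyFun]
  · refine (pderiv_coord i 2 e).trans ?_
    fin_cases i <;> simp [polyDeriv, mkDerivation_X, polyFun]
  · refine (pderiv_coord i 3 e).trans ?_
    fin_cases i <;> simp [polyDeriv, mkDerivation_X, polyFun]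
  · refine (pderiv_rad hc i e).trans ?_
    fin_cases i <;> simp [polyDeriv, mkDerivation_X, polyFun, gens, mul_comm]
  · refine (pderiv_inv_rad hc i e).trans ?_
    fin_cases i <;> simp [polyDeriv, mkDerivation_X, polyFun, gens, mul_comm]

/-- Both sides are derivations along evaluation, so agreement on the generators suffices. The class
of functions is closed under differentiation since `∂ᵤφ = u φ⁻¹` and `∂ᵤφ⁻¹ = -u φ⁻³`. Curvature
thereby becomes a purely algebraic computation. -/
lemma pderiv_polyFun {c : ℝ} (hc : 0 < c) (i : Fin 4) (p : MvPolynomial (Fin 5) ℝ) :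
    pderiv i (polyFun c p) = polyFun c (polyDeriv i p) := by
  funext e
  induction p using MvPolynomial.induction_on with
  | C a =>
    have : polyFun c (C a) = fun _ => a := by funext e; simp [polyFun]
    rw [this]
    simp [pderiv, polyFun, polyDeriv]
  | add p q hp hq =>
    have : polyFun c (p + q) = polyFun c p + polyFun c q := by funext e; simp [polyFun]
    rw [this, map_add, pderiv, fderiv_add (differentiable_polyFun hc p e)
      (differentiable_polyFun hc q e)]
    simp only [pderiv] at hp hq
    simp [polyFun, hp, hq]
  | mul_X p j hp =>
    have : polyFun c (p * X j) = polyFun c p * fun e => gens c e j := by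
      funext e; simp [polyFun]
    have hj := pderiv_gens hc i j e
    rw [this, Derivation.leibniz, pderiv, fderiv_mul (differentiable_polyFun hc p e)
      ((contDiff_gens hc j).differentiable (by simp) e)]
    simp only [pderiv] at hp hj
    simp only [add_apply, smul_apply, hp, hj]
    simp [polyFun]

/-! ### Christoffel symbols and Ricci tensor in coordinates -/

/-- The coefficients of the metric in the global coordinates. -/
def metricPoly : Matrix (Fin 4) (Fin 4) (MvPolynomial (Fin 5) ℝ) :=
  !![X 3, 0, 0, 0;
    0, X 3 + X 4 * X 0 ^ 2 * (X 1 ^ 2 + X 2 ^ 2), X 4 * X 0 * X 2, -(X 4 * X 0 * X 1);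
    0, X 4 * X 0 * X 2, X 4, 0;
    0, -(X 4 * X 0 * X 1), 0, X 4]

/-- The coefficients of the inverse of the metric. -/
def invMetricPoly : Matrix (Fin 4) (Fin 4) (MvPolynomial (Fin 5) ℝ) :=
  !![X 4, 0, 0, 0;
    0, X 4, -(X 4 * X 0 * X 2), X 4 * X 0 * X 1;
    0, -(X 4 * X 0 * X 2), X 3 + X 4 * X 0 ^ 2 * X 2 ^ 2, -(X 4 * X 0 ^ 2 * X 1 * X 2);
    0, X 4 * X 0 * X 1, -(X 4 * X 0 ^ 2 * X 1 * X 2), X 3 + X 4 * X 0 ^ 2 * X 1 ^ 2]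

/-- Twice the Christoffel symbols of the metric. -/
def christoffelPoly : Fin 4 → Matrix (Fin 4) (Fin 4) (MvPolynomial (Fin 5) ℝ) :=
  let x := X 0
  let u := X 1
  let v := X 2
  let k := X 4 ^ 2
  ![!![0, 0, u * k, v * k;
      0, -(C 2 * x * (u ^ 2 + v ^ 2) * k), -(v * k), u * k;
      u * k, -(v * k), 0, 0;
      v * k, u * k, 0, 0],
    !![0, x * (u ^ 2 + v ^ 2) * k, v * k, -(u * k);
      x * (u ^ 2 + v ^ 2) * k, 0, u * k, v * k;
      v * k, u * k, 0, 0;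
      -(u * k), v * k, 0, 0],
    !![-u, v - x ^ 2 * v * (u ^ 2 + v ^ 2) * k, -(x * v ^ 2 * k), x * u * v * k;
      v - x ^ 2 * v * (u ^ 2 + v ^ 2) * k, -u - C 2 * x ^ 2 * u + x ^ 2 * u * (u ^ 2 + v ^ 2) * k,
        -(x * u * v * k), C 2 * x - x * (C 2 * v ^ 2 + u ^ 2) * k;
      -(x * v ^ 2 * k), -(x * u * v * k), -(u * k), -(v * k);
      x * u * v * k, C 2 * x - x * (C 2 * v ^ 2 + u ^ 2) * k, -(v * k), u * k],
    !![-v, -u + x ^ 2 * u * (u ^ 2 + v ^ 2) * k, x * u * v * k, -(x * u ^ 2 * k);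
      -u + x ^ 2 * u * (u ^ 2 + v ^ 2) * k, -v - C 2 * x ^ 2 * v + x ^ 2 * v * (u ^ 2 + v ^ 2) * k,
        -(C 2 * x) + x * (v ^ 2 + C 2 * u ^ 2) * k, x * u * v * k;
      x * u * v * k, -(C 2 * x) + x * (v ^ 2 + C 2 * u ^ 2) * k, v * k, -(u * k);
      -(x * u ^ 2 * k), x * u * v * k, -(u * k), -(v * k)]]

/-- The coefficient matrix of the metric in the global coordinates. -/
def coeffMatrix (c : ℝ) (e : Mdl 4) : Matrix (Fin 4) (Fin 4) ℝ :=
  Matrix.of fun i j => polyFun c (metricPoly i j) e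

lemma coeffMatrix_inv {c : ℝ} (hc : 0 < c) (e : Mdl 4) :
    (coeffMatrix c e)⁻¹ = Matrix.of fun i j => polyFun c (invMetricPoly i j) e := by
  have hr := (rad_pos hc e).ne'
  refine Matrix.inv_eq_right_inv ?_
  ext i j
  fin_cases i <;> fin_cases j <;>
    simp [Matrix.mul_apply, Fin.sum_univ_four, coeffMatrix, metricPoly, invMetricPoly, polyFun,
      gens] <;> field_simp <;> ring

set_option maxHeartbeats 4000000 in
lemma christoffel_coeffMatrix {c : ℝ} (hc : 0 < c) (k i j : Fin 4) :
    christoffel (coeffMatrix c) k i j = polyFun c (C (1 / 2) * christoffelPoly k i j) := by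
  funext e
  have hr := (rad_pos hc e).ne'
  have h : ∀ i j l, pderiv i (fun w => coeffMatrix c w j l) e =
      polyFun c (polyDeriv i (metricPoly j l)) e := fun i j l =>
    congrFun (pderiv_polyFun hc i (metricPoly j l)) e
  simp only [christoffel, coeffMatrix_inv hc, h, Matrix.of_apply, Fin.sum_univ_four, polyFun]
  -- Beyond the derivative rules only `φ ≠ 0` is needed; the relation `φ² = u² + v² + c²` plays no
  -- role.
  fin_cases k <;> fin_cases i <;> fin_cases j <;>
    simp [metricPoly, invMetricPoly, christoffelPoly, polyDeriv, mkDerivation_X, gens] <;>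
    field_simp <;> ring

set_option maxHeartbeats 4000000 in
lemma ricciCoeff_coeffMatrix {c : ℝ} (hc : 0 < c) (e : Mdl 4) :
    ricciCoeff (coeffMatrix c) e = Matrix.diagonal ![-1, -1, 0, 0] := by
  ext j k
  simp only [ricciCoeff, riemCoeff, christoffel_coeffMatrix hc, pderiv_polyFun hc, Matrix.of_apply,
    Fin.sum_univ_four, polyFun]
  -- The listed Christoffel symbols contain `φ` only through `φ⁻²`, with no positive power to
  -- cancel. The claim is then an identity of polynomials in `x, u, v, φ⁻¹`, within reach of `ring`.
  fin_cases j <;> fin_cases k <;>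
    simp [christoffelPoly, polyDeriv, mkDerivation_X, gens] <;> ring

/-! ### The metric and the complex structure as smooth tensors -/

/-- The form `α = du + x v dy` in the global coordinates. -/
def coframeU (e : Mdl 4) : Mdl 4 →L[ℝ] ℝ :=
  EuclideanSpace.proj (2 : Fin 4) + (e 0 * e 3) • EuclideanSpace.proj (1 : Fin 4)

/-- The form `β = dv - x u dy` in the global coordinates. -/
def coframeV (e : Mdl 4) : Mdl 4 →L[ℝ] ℝ :=
  EuclideanSpace.proj (3 : Fin 4) - (e 0 * e 2) • EuclideanSpace.proj (1 : Fin 4)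

lemma contDiff_coframeU : ContDiff ℝ ∞ coframeU := by
  unfold coframeU
  fun_prop

lemma contDiff_coframeV : ContDiff ℝ ∞ coframeV := by
  unfold coframeV
  fun_prop

/-- The metric `φ (dx² + dy²) + φ⁻¹ (α² + β²)` in the global coordinates, as a bilinear form. -/
def metricBilin (c : ℝ) (e : Mdl 4) : Mdl 4 →L[ℝ] Mdl 4 →L[ℝ] ℝ :=
  ContinuousLinearMap.smulRight (EuclideanSpace.proj (0 : Fin 4) : Mdl 4 →L[ℝ] ℝ)
      (rad c e • (EuclideanSpace.proj (0 : Fin 4) : Mdl 4 →L[ℝ] ℝ)) +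
    ContinuousLinearMap.smulRight (EuclideanSpace.proj (1 : Fin 4) : Mdl 4 →L[ℝ] ℝ)
      (rad c e • (EuclideanSpace.proj (1 : Fin 4) : Mdl 4 →L[ℝ] ℝ)) +
    ContinuousLinearMap.smulRight (coframeU e) ((rad c e)⁻¹ • coframeU e) +
    ContinuousLinearMap.smulRight (coframeV e) ((rad c e)⁻¹ • coframeV e)

lemma contDiff_metricBilin {c : ℝ} (hc : 0 < c) : ContDiff ℝ ∞ (metricBilin c) := by
  have h1 := contDiff_rad hc
  have h2 : ContDiff ℝ ∞ fun e => (rad c e)⁻¹ := h1.inv fun e => (rad_pos hc e).ne'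
  exact (((contDiff_const.smulRight (h1.smul contDiff_const)).add
    (contDiff_const.smulRight (h1.smul contDiff_const))).add
    (contDiff_coframeU.smulRight (h2.smul contDiff_coframeU))).add
    (contDiff_coframeV.smulRight (h2.smul contDiff_coframeV))

lemma metricBilin_apply (c : ℝ) (e w z : Mdl 4) :
    metricBilin c e w z = rad c e * (w 0 * z 0 + w 1 * z 1) +
      (rad c e)⁻¹ * ((w 2 + e 0 * e 3 * w 1) * (z 2 + e 0 * e 3 * z 1) +
        (w 3 - e 0 * e 2 * w 1) * (z 3 - e 0 * e 2 * z 1)) := by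
  simp [metricBilin, coframeU, coframeV]
  ring

lemma metricBilin_single (c : ℝ) (e : Mdl 4) (i j : Fin 4) :
    metricBilin c e (EuclideanSpace.single i 1) (EuclideanSpace.single j 1) =
      coeffMatrix c e i j := by
  rw [metricBilin_apply]
  fin_cases i <;> fin_cases j <;> simp [coeffMatrix, polyFun, metricPoly, gens] <;> ring

lemma metricBilin_self_pos {c : ℝ} (hc : 0 < c) (e w : Mdl 4) (hw : w ≠ 0) :
    0 < metricBilin c e w w := by
  have hr := rad_pos hc e
  have hr' := inv_pos.2 hr
  rw [metricBilin_apply]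
  by_contra! h
  refine hw ?_
  have h1 := mul_nonneg hr.le (add_nonneg (mul_self_nonneg (w 0)) (mul_self_nonneg (w 1)))
  have h2 := mul_nonneg hr'.le (add_nonneg (mul_self_nonneg (w 2 + e 0 * e 3 * w 1))
    (mul_self_nonneg (w 3 - e 0 * e 2 * w 1)))
  have h3 : w 0 * w 0 + w 1 * w 1 = 0 :=
    (mul_eq_zero.1 (le_antisymm (by linarith) h1)).resolve_left hr.ne'
  have h4 := (mul_eq_zero.1 (le_antisymm (by linarith) h2)).resolve_left hr'.ne'
  obtain ⟨h5, h6⟩ := mul_self_add_mul_self_eq_zero.1 h3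
  obtain ⟨h7, h8⟩ := mul_self_add_mul_self_eq_zero.1 h4
  rw [h6] at h7 h8
  ext i
  fin_cases i
  · exact h5
  · exact h6
  · simpa using h7
  · simpa using h8

/-- The structure of a Riemannian metric asks that its unit balls be bounded; any explicit bound at
a fixed point will do. -/
lemma norm_sq_le_of_metricBilin_lt {c : ℝ} (hc : 0 < c) {e w : Mdl 4}
    (hw : metricBilin c e w w < 1) :
    ‖w‖ ^ 2 ≤ (rad c e)⁻¹ + 2 * rad c e +
      2 * e 0 ^ 2 * (e 2 ^ 2 + e 3 ^ 2) * (rad c e)⁻¹ := by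
  have hr := rad_pos hc e
  have hr' := inv_pos.2 hr
  rw [metricBilin_apply] at hw
  rw [EuclideanSpace.norm_sq_eq, Fin.sum_univ_four]
  simp only [Real.norm_eq_abs, sq_abs]
  set A := w 2 + e 0 * e 3 * w 1 with hA
  set B := w 3 - e 0 * e 2 * w 1 with hB
  have h1 : w 0 ^ 2 + w 1 ^ 2 ≤ (rad c e)⁻¹ := by
    have h2 := mul_nonneg hr'.le (add_nonneg (mul_self_nonneg A) (mul_self_nonneg B))
    rw [← one_div, le_div_iff₀ hr]
    nlinarith
  have h2 : A ^ 2 + B ^ 2 ≤ rad c e := by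
    have h2 := mul_nonneg hr.le (add_nonneg (mul_self_nonneg (w 0)) (mul_self_nonneg (w 1)))
    have h3 : (rad c e)⁻¹ * (A ^ 2 + B ^ 2) ≤ 1 := by nlinarith
    rwa [inv_mul_le_iff₀ hr, mul_one] at h3
  -- Here `w 2 = A - x v w₁`, and `(a - b)² ≤ 2a² + 2b²`.
  have h3 : w 2 ^ 2 ≤ 2 * A ^ 2 + 2 * (e 0 * e 3 * w 1) ^ 2 := by
    nlinarith [sq_nonneg (A + e 0 * e 3 * w 1)]
  have h4 : w 3 ^ 2 ≤ 2 * B ^ 2 + 2 * (e 0 * e 2 * w 1) ^ 2 := by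
    nlinarith [sq_nonneg (B - e 0 * e 2 * w 1)]
  have h5 : 2 * e 0 ^ 2 * (e 2 ^ 2 + e 3 ^ 2) * w 1 ^ 2 ≤
      2 * e 0 ^ 2 * (e 2 ^ 2 + e 3 ^ 2) * (rad c e)⁻¹ :=
    mul_le_mul_of_nonneg_left (by nlinarith [sq_nonneg (w 0)]) (by positivity)
  nlinarith

lemma isVonNBounded_metricBilin {c : ℝ} (hc : 0 < c) (e : Mdl 4) :
    Bornology.IsVonNBounded ℝ {w : Mdl 4 | metricBilin c e w w < 1} := by
  rw [NormedSpace.isVonNBounded_iff, isBounded_iff_forall_norm_le]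
  exact ⟨_, fun w hw => Real.le_sqrt_of_sq_le (norm_sq_le_of_metricBilin_lt hc hw)⟩

/-- The metric on the bundle. -/
def metric {c : ℝ} (hc : 0 < c) : RiemMetric 4 HeisBundle where
  inner p := metricBilin c (coord p)
  symm p w z := (metricBilin_apply c (coord p) w z).trans
    ((by ring : _ = _).trans (metricBilin_apply c (coord p) z w).symm)
  pos p w hw := metricBilin_self_pos hc (coord p) w hw
  isVonNBounded p := isVonNBounded_metricBilin hc (coord p)
  contMDiff := contMDiff_bilinear (contDiff_metricBilin hc)

/-- The constant part of the almost complex structure in the global coordinates. -/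
def complexConst : Mdl 4 →L[ℝ] Mdl 4 :=
  LinearMap.toContinuousLinearMap
    { toFun := fun w => !₂[-w 1, w 0, w 3, -w 2]
      map_add' := fun w z => by ext i; fin_cases i <;> simp <;> ring
      map_smul' := fun a w => by ext i; fin_cases i <;> simp }

/-- The coefficient of `x u` in the almost complex structure in the global coordinates. -/
def complexCoeffU : Mdl 4 →L[ℝ] Mdl 4 :=
  LinearMap.toContinuousLinearMap
    { toFun := fun w => !₂[0, 0, -w 1, w 0]
      map_add' := fun w z => by ext i; fin_cases i <;> simp [add_comm]
      map_smul' := fun a w => by ext i; fin_cases i <;> simp }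

/-- The coefficient of `x v` in the almost complex structure in the global coordinates. -/
def complexCoeffV : Mdl 4 →L[ℝ] Mdl 4 :=
  LinearMap.toContinuousLinearMap
    { toFun := fun w => !₂[0, 0, -w 0, -w 1]
      map_add' := fun w z => by ext i; fin_cases i <;> simp <;> ring
      map_smul' := fun a w => by ext i; fin_cases i <;> simp }

/-- The almost complex structure in the global coordinates. -/
def complexEnd (e : Mdl 4) : Mdl 4 →L[ℝ] Mdl 4 :=
  complexConst + (e 0 * e 2) • complexCoeffU + (e 0 * e 3) • complexCoeffV

lemma contDiff_complexEnd : ContDiff ℝ ∞ complexEnd := by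
  unfold complexEnd
  fun_prop

lemma complexEnd_apply (e w : Mdl 4) : complexEnd e w =
    !₂[-w 1, w 0, w 3 - e 0 * e 2 * w 1 - e 0 * e 3 * w 0,
      -w 2 + e 0 * e 2 * w 0 - e 0 * e 3 * w 1] := by
  ext i
  fin_cases i <;> simp [complexEnd, complexConst, complexCoeffU, complexCoeffV] <;> ring

/-- On the coframe, `dx ∘ J = -dy`, `dy ∘ J = dx`, `α ∘ J = β` and `β ∘ J = -α`. The same relations
make `J` orthogonal in `metric_hermitian`. -/
lemma complexEnd_sq (e w : Mdl 4) : complexEnd e (complexEnd e w) = -w := by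
  ext i
  fin_cases i <;> simp [complexEnd_apply] <;> ring

/-- The almost complex structure on the bundle. -/
def complexStr : AlmostComplex 4 HeisBundle where
  J p := complexEnd (coord p)
  sq p w := complexEnd_sq (coord p) w
  smooth := contMDiff_endomorphism contDiff_complexEnd

/-! ### Ricci curvature and central flatness -/

lemma metricCoeff_metric {c : ℝ} (hc : 0 < c) (p : HeisBundle) :
    metricCoeff (metric hc) p = coeffMatrix c := by
  funext y
  ext i j
  have h : ∀ (f : Mdl 4 → HeisBundle) (w z : Mdl 4), f = ofCoord →
      w = EuclideanSpace.single i 1 → z = EuclideanSpace.single j 1 →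
      metricBilin c (coord (f y)) w z = coeffMatrix c y i j := by
    rintro f w z rfl rfl rfl
    rw [coord_ofCoord, metricBilin_single]
  exact h _ _ _ (coe_extChartAt_symm p) (coordVec_eq p y i) (coordVec_eq p y j)

lemma ricciMatrix_metric {c : ℝ} (hc : 0 < c) (p : HeisBundle) :
    ricciMatrix (metric hc) p = Matrix.diagonal ![-1, -1, 0, 0] := by
  rw [ricciMatrix, metricCoeff_metric, ricciCoeff_coeffMatrix hc]

lemma ricci_metric {c : ℝ} (hc : 0 < c) (p : HeisBundle) (w z : Mdl 4) :
    ricci (metric hc) p w z = -(w 0 * z 0 + w 1 * z 1) := by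
  have h : ricci (metric hc) p w z = ∑ i, ∑ j, ricciMatrix (metric hc) p i j * w i * z j := by
    refine Finset.sum_congr rfl fun i _ => Finset.sum_congr rfl fun j _ => ?_
    rw [vecCoord_eq, vecCoord_eq]
  rw [h, ricciMatrix_metric]
  simp [Fin.sum_univ_four, Matrix.diagonal]
  ring

lemma ricciDet_metric {c : ℝ} (hc : 0 < c) (p : HeisBundle) : ricciDet (metric hc) p = 0 := by
  rw [ricciDet, ricciMatrix_metric, Matrix.det_mul, Matrix.det_diagonal]
  simp [Fin.prod_univ_four]

lemma not_isRicciFlat_metric {c : ℝ} (hc : 0 < c) : ¬ IsRicciFlat (metric hc) := by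
  intro h
  have h1 := h (ofCoord 0) (EuclideanSpace.single 0 1 : Mdl 4) (EuclideanSpace.single 0 1 : Mdl 4)
  have h2 := ricci_metric hc (ofCoord 0) (EuclideanSpace.single 0 1) (EuclideanSpace.single 0 1)
  rw [h1] at h2
  simp at h2

lemma ricciForm_metric {c : ℝ} (hc : 0 < c) (p : HeisBundle) (w z : Mdl 4) :
    ricciForm (metric hc) complexStr p w z = w 1 * z 0 - w 0 * z 1 := by
  refine (ricci_metric hc p (complexEnd (coord p) w) z).trans ?_
  rw [complexEnd_apply]
  simp
  ring

/-- The Ricci form is `-dx ∧ dy`, which is decomposable; what remains is a Plücker identity. -/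
lemma hasCentralCurvature_metric {c : ℝ} (hc : 0 < c) :
    HasCentralCurvature (metric hc) complexStr 0 := by
  intro p u₁ u₂ u₃ u₄
  rw [zero_mul, wedgeSq]
  have h := ricciForm_metric hc p
  rw [h u₁ u₂, h u₃ u₄, h u₁ u₃, h u₂ u₄, h u₁ u₄, h u₂ u₃]
  ring

/-! ### The Kähler property -/

/-- The coefficients of the fundamental form in the global coordinates. -/
def formPoly : Matrix (Fin 4) (Fin 4) (MvPolynomial (Fin 5) ℝ) :=
  !![0, X 3, 0, 0;
    -X 3, 0, -(X 4 * X 0 * X 1), -(X 4 * X 0 * X 2);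
    0, X 4 * X 0 * X 1, 0, -X 4;
    0, X 4 * X 0 * X 2, X 4, 0]

lemma fundForm_metric {c : ℝ} (hc : 0 < c) (p : HeisBundle) (w z : Mdl 4) :
    fundForm (metric hc) complexStr p w z =
      metricBilin c (coord p) (complexEnd (coord p) w) z := rfl

lemma fundCoeff_metric {c : ℝ} (hc : 0 < c) (p : HeisBundle) (i j : Fin 4) :
    fundCoeff (metric hc) complexStr p i j = polyFun c (formPoly i j) := by
  funext y
  have h : ∀ (f : Mdl 4 → HeisBundle) (w z : Mdl 4), f = ofCoord →
      w = EuclideanSpace.single i 1 → z = EuclideanSpace.single j 1 →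
      metricBilin c (coord (f y)) (complexEnd (coord (f y)) w) z = polyFun c (formPoly i j) y := by
    rintro f w z rfl rfl rfl
    rw [coord_ofCoord, complexEnd_apply, metricBilin_apply]
    fin_cases i <;> fin_cases j <;> simp [polyFun, formPoly, gens] <;>
      first | ring1 | exact Or.inr (by ring)
  exact h _ _ _ (coe_extChartAt_symm p) (coordVec_eq p y i) (coordVec_eq p y j)

/-- Off the zero section `ω = d(φ σ₃)`, but `σ₃` is singular there. Working with the components of
`φ dx ∧ dy - φ⁻¹ α ∧ β` treats all points at once. -/
lemma closed_fundForm_metric {c : ℝ} (hc : 0 < c) (p : HeisBundle) (i j k : Fin 4) (y : Mdl 4) :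
    pderiv i (fundCoeff (metric hc) complexStr p j k) y
      + pderiv j (fundCoeff (metric hc) complexStr p k i) y
      + pderiv k (fundCoeff (metric hc) complexStr p i j) y = 0 := by
  simp only [fundCoeff_metric, pderiv_polyFun hc, polyFun]
  have hr := (rad_pos hc y).ne'
  fin_cases i <;> fin_cases j <;> fin_cases k <;>
    simp [formPoly, polyDeriv, mkDerivation_X, gens] <;> field_simp <;> ring

lemma metric_inner {c : ℝ} (hc : 0 < c) (p : HeisBundle) (w z : Mdl 4) :
    (metric hc).inner p w z = metricBilin c (coord p) w z := rfl

lemma complexStr_J (p : HeisBundle) (w : Mdl 4) :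
    complexStr.J p w = complexEnd (coord p) w := rfl

lemma metric_hermitian {c : ℝ} (hc : 0 < c) (p : HeisBundle) (w z : Mdl 4) :
    (metric hc).inner p (complexStr.J p w) (complexStr.J p z) = (metric hc).inner p w z := by
  rw [metric_inner, complexStr_J, complexStr_J]
  refine (metric_inner hc p _ _).trans ?_
  rw [metricBilin_apply, metricBilin_apply, complexEnd_apply, complexEnd_apply]
  simp
  ring

/-- Global holomorphic coordinates `(x + i y, (u - i v) e^{-x²/2})`. -/
def holoCoord (e : Mdl 4) : ℂ × ℂ :=
  ((e 0 : ℂ) + Complex.I * (e 1 : ℂ),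
    ((e 2 : ℂ) - Complex.I * (e 3 : ℂ)) * Complex.exp (-(e 0 : ℂ) ^ 2 / 2))

lemma contDiff_holoCoord : ContDiff ℝ ∞ holoCoord := by
  have h : ∀ i : Fin 4, ContDiff ℝ ∞ fun e : Mdl 4 => (e i : ℂ) := fun i =>
    Complex.ofRealCLM.contDiff.comp (by fun_prop)
  exact ((h 0).add (contDiff_const.mul (h 1))).prodMk
    (((h 2).sub (contDiff_const.mul (h 3))).mul (((h 0).pow 2).neg.div_const 2).cexp)

lemma fderiv_holoCoord (e w : Mdl 4) : fderiv ℝ holoCoord e w =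
    ((w 0 : ℂ) + Complex.I * (w 1 : ℂ),
      ((w 2 : ℂ) - Complex.I * (w 3 : ℂ) - ((e 2 : ℂ) - Complex.I * (e 3 : ℂ)) * (e 0 : ℂ) * (w 0 : ℂ))
        * Complex.exp (-(e 0 : ℂ) ^ 2 / 2)) := by
  have h : ∀ i : Fin 4, HasFDerivAt (fun e : Mdl 4 => (e i : ℂ))
      (Complex.ofRealCLM.comp (EuclideanSpace.proj (𝕜 := ℝ) i : Mdl 4 →L[ℝ] ℝ)) e := fun i =>
    (Complex.ofRealCLM.comp (EuclideanSpace.proj (𝕜 := ℝ) i : Mdl 4 →L[ℝ] ℝ)).hasFDerivAt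
  have h1 : HasFDerivAt (fun e : Mdl 4 => (e 0 : ℂ) + Complex.I * (e 1 : ℂ)) _ e :=
    (h 0).add ((h 1).const_mul Complex.I)
  have h2 : HasFDerivAt (fun e : Mdl 4 => (e 2 : ℂ) - Complex.I * (e 3 : ℂ)) _ e :=
    (h 2).sub ((h 3).const_mul Complex.I)
  have h3 : HasFDerivAt (fun e : Mdl 4 => Complex.exp (-(1 / 2) * (e 0 : ℂ) ^ 2)) _ e :=
    (((h 0).pow 2).const_mul (-(1 / 2) : ℂ)).cexp
  have h3' : (fun e : Mdl 4 => Complex.exp (-(e 0 : ℂ) ^ 2 / 2)) =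
      fun e : Mdl 4 => Complex.exp (-(1 / 2) * (e 0 : ℂ) ^ 2) := by
    funext e
    congr 1
    ring
  have h4 : HasFDerivAt holoCoord _ e := h1.prodMk (h2.mul (h3' ▸ h3))
  rw [h4.fderiv]
  have h5 : -(e 0 : ℂ) ^ 2 / 2 = -(1 / 2) * (e 0 : ℂ) ^ 2 := by ring
  ext1
  · simp
  · simp [h5]
    ring

lemma fderiv_holoCoord_bijective (e : Mdl 4) : Function.Bijective (fderiv ℝ holoCoord e) := by
  have hE := Complex.exp_ne_zero (-(e 0 : ℂ) ^ 2 / 2)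
  constructor
  · rw [injective_iff_map_eq_zero]
    intro w hw
    rw [fderiv_holoCoord, Prod.mk_eq_zero] at hw
    obtain ⟨h1, h2⟩ := hw
    have h0 : w 0 = 0 := by simpa using congrArg Complex.re h1
    have h1' : w 1 = 0 := by simpa using congrArg Complex.im h1
    replace h2 := (mul_eq_zero.1 h2).resolve_right hE
    rw [h0] at h2
    have h2' : w 2 = 0 := by simpa using congrArg Complex.re h2
    have h3 : w 3 = 0 := by simpa using congrArg Complex.im h2
    ext i
    fin_cases i <;> assumption
  · rintro ⟨a, b⟩
    -- The differential is triangular: its first component determines `w₀, w₁`, and the second is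
    -- then solved for `w₂ - i w₃ = d`.
    set d : ℂ := b / Complex.exp (-(e 0 : ℂ) ^ 2 / 2) +
      ((e 2 : ℂ) - Complex.I * (e 3 : ℂ)) * (e 0 : ℂ) * (a.re : ℂ) with hd
    refine ⟨!₂[a.re, a.im, d.re, -d.im], ?_⟩
    rw [fderiv_holoCoord]
    have h1 : (a.re : ℂ) + Complex.I * (a.im : ℂ) = a := by
      rw [mul_comm, Complex.re_add_im]
    have h2 : (d.re : ℂ) - Complex.I * ((-d.im : ℝ) : ℂ) = d := by
      push_cast
      rw [mul_neg, sub_neg_eq_add, mul_comm, Complex.re_add_im]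
    ext1
    · exact h1
    · change ((d.re : ℂ) - Complex.I * ((-d.im : ℝ) : ℂ) - _ * (a.re : ℂ)) * _ = b
      rw [h2, hd, add_sub_cancel_right, div_mul_cancel₀ _ hE]

/-- With `ζ = u - iv`, the forms `dx + i dy` and `α - iβ` are of type `(1,0)`, and `dζ = α - iβ - i
x ζ dy`. The factor `e^{-x²/2}` adds `-x ζ dx`, which completes the error term to `-x ζ (dx + i
dy)`. -/
lemma fderiv_holoCoord_complexEnd (e w : Mdl 4) :
    fderiv ℝ holoCoord e (complexEnd e w) = Complex.I • fderiv ℝ holoCoord e w := by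
  rw [fderiv_holoCoord, fderiv_holoCoord, complexEnd_apply, Prod.smul_mk]
  have hI := Complex.I_sq
  ext1
  · simp
    linear_combination -(w 1 : ℂ) * hI
  · simp
    linear_combination
      Complex.exp (-(e 0 : ℂ) ^ 2 / 2) * ((w 3 : ℂ) - (e 0 : ℂ) * (e 3 : ℂ) * (w 0 : ℂ)) * hI

lemma diffC_holoCoord_coord (p : HeisBundle) (w : Mdl 4) :
    diffC (fun p => holoCoord (coord p)) p w = fderiv ℝ holoCoord (coord p) w := by
  have h := mfderiv_eq_fderiv_comp_ofCoord (f := fun p => holoCoord (coord p)) p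
    ((contDiff_holoCoord.contMDiff.comp contMDiff_coord).mdifferentiable (by simp) p)
  simp only [coord_ofCoord] at h
  exact congrArg (fun L : Mdl 4 →L[ℝ] ℂ × ℂ => L w) h

lemma isKahler_metric {c : ℝ} (hc : 0 < c) : IsKahler (metric hc) complexStr where
  hermitian := metric_hermitian hc
  integrable p := by
    refine ⟨Set.univ, isOpen_univ, Set.mem_univ p, fun p => holoCoord (coord p),
      (contDiff_holoCoord.contMDiff.comp contMDiff_coord).contMDiffOn, fun q _ => ?_⟩
    have h : diffC (fun p => holoCoord (coord p)) q = fderiv ℝ holoCoord (coord q) :=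
      funext (diffC_holoCoord_coord q)
    rw [h]
    exact ⟨fderiv_holoCoord_bijective (coord q), fderiv_holoCoord_complexEnd (coord q)⟩
  closed p i j k := closed_fundForm_metric hc p i j k _

/-! ### Comparison with the given tensors on the regular part -/

lemma coord_regPt (a : Mdl 4) : coord (regPt a) =
    !₂[a 0, a 1, Real.exp (a 3) * Real.cos (a 2), Real.exp (a 3) * Real.sin (a 2)] := by
  rw [regPt, coord_mk]
  ext i
  fin_cases i
  · rfl
  · rfl
  · simp [Circle.coe_exp, Complex.exp_re, Complex.exp_im, mul_comm]
  · simp [Circle.coe_exp, Complex.exp_re, Complex.exp_im, mul_comm]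

lemma hasFDerivAt_coord_regPt (a : Mdl 4) : ∃ L : Mdl 4 →L[ℝ] Mdl 4,
    HasFDerivAt (fun a => coord (regPt a)) L a ∧
    ∀ w, L w = !₂[w 0, w 1,
      Real.exp (a 3) * (Real.cos (a 2) * w 3 - Real.sin (a 2) * w 2),
      Real.exp (a 3) * (Real.sin (a 2) * w 3 + Real.cos (a 2) * w 2)] := by
  have h : ∀ i : Fin 4, HasFDerivAt (fun e : Mdl 4 => e i) (EuclideanSpace.proj (𝕜 := ℝ) i) a :=
    fun i => (EuclideanSpace.proj (𝕜 := ℝ) i).hasFDerivAt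
  have hd : DifferentiableAt ℝ (fun a => coord (regPt a)) a := by
    simp only [coord_regPt]
    rw [differentiableAt_euclidean]
    intro i
    fin_cases i <;> simp <;> fun_prop
  refine ⟨_, hd.hasFDerivAt, fun w => ?_⟩
  -- Uniqueness of the derivative reduces the computation to one scalar component at a time.
  have hi : ∀ (i : Fin 4) (L : Mdl 4 →L[ℝ] ℝ), HasFDerivAt (fun a => coord (regPt a) i) L a →
      fderiv ℝ (fun a => coord (regPt a)) a w i = L w := by
    intro i L hL
    have h2 := (EuclideanSpace.proj (𝕜 := ℝ) i : Mdl 4 →L[ℝ] ℝ).hasFDerivAt.comp a hd.hasFDerivAt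
    exact DFunLike.congr_fun (h2.unique hL) w
  simp only [coord_regPt] at hi
  simp only [coord_regPt]
  ext i
  fin_cases i
  · exact hi 0 _ (h 0)
  · exact hi 1 _ (h 1)
  · refine (hi 2 _ ((h 3).exp.mul (h 2).cos)).trans ?_
    simp
    ring
  · refine (hi 3 _ ((h 3).exp.mul (h 2).sin)).trans ?_
    simp
    ring

lemma dReg_eq (a w : Mdl 4) : dReg a w = (!₂[w 0, w 1,
      Real.exp (a 3) * (Real.cos (a 2) * w 3 - Real.sin (a 2) * w 2),
      Real.exp (a 3) * (Real.sin (a 2) * w 3 + Real.cos (a 2) * w 2)] : Mdl 4) := by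
  obtain ⟨L, hL, hw⟩ := hasFDerivAt_coord_regPt a
  have hd : MDifferentiableAt (𝓡 4) (𝓡 4) regPt a := by
    have h1 : regPt = fun a => ofCoord (coord (regPt a)) := funext fun a => (ofCoord_coord _).symm
    rw [h1]
    exact (contMDiff_ofCoord.mdifferentiable (by simp) _).comp a
      hL.differentiableAt.mdifferentiableAt
  rw [← hw, ← hL.fderiv]
  exact congrArg (fun L : Mdl 4 →L[ℝ] Mdl 4 => L w) (mfderiv_eq_fderiv_coord_comp a hd)

lemma exp_two_mul (q : ℝ) : Real.exp (2 * q) = Real.exp q ^ 2 := by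
  rw [← Real.exp_nat_mul]
  norm_num

lemma rad_coord_regPt (c : ℝ) (a : Mdl 4) : rad c (coord (regPt a)) = phi c (a 3) := by
  rw [rad, phi, coord_regPt, exp_two_mul]
  congr 2
  simp
  linear_combination Real.exp (a 3) ^ 2 * Real.sin_sq_add_cos_sq (a 2)

/-- The pullback of `α + iβ` is `e^{q + iz}(dq - iσ₃)`; the phase drops out through `sin² + cos² =
1`, leaving the factor `e^{2q}`. -/
lemma metric_dReg {c : ℝ} (hc : 0 < c) (a w z : Mdl 4) :
    (metric hc).inner (regPt a) (dReg a w) (dReg a z) = biaxial c a w z := by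
  rw [dReg_eq, dReg_eq]
  refine (metric_inner hc _ _ _).trans ?_
  rw [metricBilin_apply, rad_coord_regPt, coord_regPt, biaxial, exp_two_mul]
  simp [dq, sig₁, sig₂, sig₃]
  linear_combination (phi c (a 3))⁻¹ * Real.exp (a 3) ^ 2 *
    (w 3 * z 3 + (a 0 * w 1 - w 2) * (a 0 * z 1 - z 2)) * Real.sin_sq_add_cos_sq (a 2)

lemma fundForm_dReg {c : ℝ} (hc : 0 < c) (a w z : Mdl 4) :
    fundForm (metric hc) complexStr (regPt a) (dReg a w) (dReg a z) = biaxialForm c a w z := by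
  rw [dReg_eq, dReg_eq]
  refine (fundForm_metric hc _ _ _).trans ?_
  rw [metricBilin_apply, complexEnd_apply, rad_coord_regPt, coord_regPt, biaxialForm,
    exp_two_mul]
  simp [dq, sig₁, sig₂, sig₃]
  linear_combination (phi c (a 3))⁻¹ * Real.exp (a 3) ^ 2 *
    (w 3 * (a 0 * z 1 - z 2) - z 3 * (a 0 * w 1 - w 2)) * Real.sin_sq_add_cos_sq (a 2)

lemma complexStr_dReg_fieldQ (a : Mdl 4) :
    complexStr.J (regPt a) (dReg a (fieldQ a)) = dReg a (fieldX₃ a) := by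
  rw [dReg_eq, dReg_eq]
  refine (complexStr_J _ _).trans ?_
  rw [complexEnd_apply]
  refine PiLp.ext fun i => ?_
  fin_cases i <;> simp [fieldQ, fieldX₃]

lemma complexStr_dReg_fieldX₁ (a : Mdl 4) :
    complexStr.J (regPt a) (dReg a (fieldX₁ a)) = dReg a (fieldX₂ a) := by
  rw [dReg_eq, dReg_eq]
  refine (complexStr_J _ _).trans ?_
  rw [complexEnd_apply, coord_regPt]
  refine PiLp.ext fun i => ?_
  fin_cases i <;> simp [fieldX₁, fieldX₂] <;> ring

end HeisBundle

/-! ### Lipschitz functions and Cauchy sequences for the Riemannian distance -/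

section LipschitzEstimate

variable {n : ℕ} {M : Type*} [TopologicalSpace M] [ChartedSpace (Mdl n) M]
  [IsManifold (𝓡 n) ∞ M]

open Set MeasureTheory in
/-- A smooth function whose differential is bounded by `1` is `1`-Lipschitz for the Riemannian
distance. -/
lemma edist_le_riemDist (g : RiemMetric n M) {f : M → ℝ} (hf : ContMDiff (𝓡 n) 𝓘(ℝ, ℝ) ∞ f)
    {D : (p : M) → TangentSpace (𝓡 n) p →L[ℝ] ℝ} (hD : ∀ p, mfderiv (𝓡 n) 𝓘(ℝ, ℝ) f p = D p)
    (hg : ∀ (p : M) (u : TangentSpace (𝓡 n) p), (D p u) ^ 2 ≤ g.inner p u u) (p q : M) :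
    edist (f p) (f q) ≤ riemDist g p q := by
  let _ : Bundle.RiemannianBundle (fun x : M => TangentSpace (𝓡 n) x) := ⟨g.toRiemannianMetric⟩
  refine le_of_forall_gt fun r hr => ?_
  obtain ⟨γ, h0, h1, hγ, hr⟩ := Manifold.exists_lt_of_riemannianEDist_lt hr
  refine lt_of_le_of_lt ?_ hr
  have hC : ContDiffOn ℝ 1 (f ∘ γ) (Icc 0 1) :=
    contMDiffOn_iff_contDiffOn.mp ((hf.of_le (by simp)).comp_contMDiffOn hγ)
  rw [Manifold.pathELength_eq_lintegral_mfderivWithin_Icc, edist_comm, edist_eq_enorm_sub, ← h0,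
    ← h1]
  -- The increment of `f` along `γ` is at most the integral of the speed of `f ∘ γ`, to be compared
  -- pointwise with the speed of `γ`.
  refine (enorm_sub_le_lintegral_derivWithin_Icc_of_contDiffOn_Icc hC zero_le_one).trans ?_
  refine setLIntegral_mono' measurableSet_Icc fun t ht => ?_
  have hu : UniqueMDiffWithinAt 𝓘(ℝ, ℝ) (Icc (0 : ℝ) 1) t :=
    uniqueMDiffWithinAt_iff_uniqueDiffWithinAt.2 (uniqueDiffOn_Icc zero_lt_one _ ht)
  have hd : derivWithin (f ∘ γ) (Icc 0 1) t =
      D (γ t) (mfderivWithin 𝓘(ℝ, ℝ) (𝓡 n) γ (Icc 0 1) t (1 : ℝ)) := by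
    have h2 := mfderiv_comp_mfderivWithin t (hf.mdifferentiable (by simp) (γ t))
      (hγ.mdifferentiableOn (by simp) t ht) hu
    rw [mfderivWithin_eq_fderivWithin, hD] at h2
    exact congrArg (fun L : ℝ →L[ℝ] ℝ => L 1) h2
  rw [hd]
  set w := mfderivWithin 𝓘(ℝ, ℝ) (𝓡 n) γ (Icc 0 1) t (1 : ℝ)
  have h3 : |D (γ t) w| ≤ ‖w‖ := by
    refine abs_le_of_sq_le_sq ?_ (norm_nonneg w)
    -- The norm on the tangent space is the one induced by `g`, so its square is the right-hand side
    -- of `hg`.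
    rw [← real_inner_self_eq_norm_sq]
    exact hg (γ t) w
  have h4 := ENNReal.ofReal_le_ofReal h3
  rw [ofReal_norm] at h4
  rwa [← Real.norm_eq_abs, ofReal_norm] at h4

lemma exists_forall_abs_le_of_cauchy (g : RiemMetric n M) {f : M → ℝ}
    (hf : ∀ p q, edist (f p) (f q) ≤ riemDist g p q) {s : ℕ → M} {N : ℕ}
    (hs : ∀ i ≥ N, riemDist g (s i) (s N) < 1) : ∃ C, ∀ i ≥ N, |f (s i)| ≤ C := by
  refine ⟨|f (s N)| + 1, fun i hi => ?_⟩
  have h := (hf (s i) (s N)).trans_lt (hs i hi)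
  rw [edist_dist, ENNReal.ofReal_lt_one, Real.dist_eq] at h
  have h2 := abs_sub_abs_le_abs_sub (f (s i)) (f (s N))
  linarith

/-- A Cauchy sequence with a subsequence that converges in the topology of the manifold converges
for the Riemannian distance. -/
lemma tendsto_riemDist_of_subseq (g : RiemMetric n M) {s : ℕ → M}
    (hs : ∀ ε : ENNReal, 0 < ε → ∃ N, ∀ i ≥ N, ∀ j ≥ N, riemDist g (s i) (s j) < ε)
    {k : ℕ → ℕ} (hk : Filter.Tendsto k Filter.atTop Filter.atTop) {p : M}
    (hp : Filter.Tendsto (fun i => s (k i)) Filter.atTop (𝓝 p)) :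
    Filter.Tendsto (fun i => riemDist g (s i) p) Filter.atTop (𝓝 0) := by
  let _ : Bundle.RiemannianBundle (fun x : M => TangentSpace (𝓡 n) x) := ⟨g.toRiemannianMetric⟩
  have : IsManifold (𝓡 n) 1 M := IsManifold.of_le (n := ∞) (by simp)
  -- Regularity of the metric is what makes points near `p` in the manifold topology close to `p` in
  -- the distance.
  have : IsContMDiffRiemannianBundle (𝓡 n) ∞ (Mdl n) (fun x : M => TangentSpace (𝓡 n) x) :=
    ⟨g.inner, g.contMDiff, fun _ _ _ => rfl⟩
  have : IsContinuousRiemannianBundle (Mdl n) (fun x : M => TangentSpace (𝓡 n) x) :=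
    ⟨g.inner, g.contMDiff.continuous, fun _ _ _ => rfl⟩
  rw [ENNReal.tendsto_atTop_zero]
  intro ε hε
  have hε2 : 0 < ε / 2 := ENNReal.half_pos hε.ne'
  obtain ⟨N, hN⟩ := hs _ hε2
  refine ⟨N, fun i hi => ?_⟩
  obtain ⟨m, hm1, hm2⟩ := ((hp.eventually (eventually_riemannianEDist_lt (I := 𝓡 n) p hε2)).and
    (hk.eventually_ge_atTop N)).exists
  have h1 := hN i hi (k m) hm2
  have h2 : riemDist g (s i) p ≤ riemDist g (s i) (s (k m)) + riemDist g (s (k m)) p :=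
    Manifold.riemannianEDist_triangle
  have h3 : riemDist g (s (k m)) p < ε / 2 := by
    unfold riemDist
    rw [Manifold.riemannianEDist_comm]
    exact hm1
  exact h2.trans ((add_le_add h1.le h3.le).trans_eq (ENNReal.add_halves ε))

end LipschitzEstimate

/-! ### Completeness -/

namespace HeisBundle

lemma edist_comp_coord_le {c : ℝ} (hc : 0 < c) {f : Mdl 4 → ℝ} (hf : ContDiff ℝ ∞ f)
    (hg : ∀ e w, (fderiv ℝ f e w) ^ 2 ≤ metricBilin c e w w) (p q : HeisBundle) :
    edist (f (coord p)) (f (coord q)) ≤ riemDist (metric hc) p q := by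
  have hm : ContMDiff (𝓡 4) 𝓘(ℝ, ℝ) ∞ fun p => f (coord p) := hf.contMDiff.comp contMDiff_coord
  refine edist_le_riemDist (metric hc) hm (D := fun p => fderiv ℝ f (coord p)) (fun p => ?_)
    (fun p w => hg (coord p) w) p q
  have h := mfderiv_eq_fderiv_comp_ofCoord (f := fun p => f (coord p)) p
    (hm.mdifferentiable (by simp) p)
  simp only [coord_ofCoord] at h
  exact h

lemma le_metricBilin_self {c : ℝ} (hc : 0 < c) (e w : Mdl 4) :
    c * (w 0 ^ 2 + w 1 ^ 2) ≤ metricBilin c e w w := by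
  have hr := rad_pos hc e
  have h1 : c ≤ rad c e := Real.le_sqrt_of_sq_le (by nlinarith [sq_nonneg (e 2), sq_nonneg (e 3)])
  have h2 := mul_nonneg (inv_pos.2 hr).le (add_nonneg (mul_self_nonneg (w 2 + e 0 * e 3 * w 1))
    (mul_self_nonneg (w 3 - e 0 * e 2 * w 1)))
  have h3 := mul_le_mul_of_nonneg_right h1 (add_nonneg (sq_nonneg (w 0)) (sq_nonneg (w 1)))
  rw [metricBilin_apply]
  nlinarith

lemma fderiv_sqrt_mul_coord_sq_le {c : ℝ} (hc : 0 < c) (i : Fin 4) (hi : i = 0 ∨ i = 1)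
    (e w : Mdl 4) :
    (fderiv ℝ (fun e : Mdl 4 => Real.sqrt c * e i) e w) ^ 2 ≤ metricBilin c e w w := by
  have h : HasFDerivAt (fun e : Mdl 4 => Real.sqrt c * e i) _ e :=
    (EuclideanSpace.proj (𝕜 := ℝ) i : Mdl 4 →L[ℝ] ℝ).hasFDerivAt.const_mul (Real.sqrt c)
  refine le_trans ?_ (le_metricBilin_self hc e w)
  rw [h.fderiv]
  simp only [smul_apply, PiLp.proj_apply, smul_eq_mul, mul_pow, Real.sq_sqrt hc.le]
  rcases hi with rfl | rfl <;> refine mul_le_mul_of_nonneg_left ?_ hc.le <;>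
    nlinarith [sq_nonneg (w 0), sq_nonneg (w 1)]

/-- The square root is the right scale: `φ dφ = u α + v β` gives `|dφ|² ≤ φ`, hence `|d√φ|² ≤ 1/4`,
whereas `φ` itself is not Lipschitz. -/
lemma fderiv_sqrt_rad_sq_le {c : ℝ} (hc : 0 < c) (e w : Mdl 4) :
    (fderiv ℝ (fun e => Real.sqrt (rad c e)) e w) ^ 2 ≤ metricBilin c e w w := by
  have hr := rad_pos hc e
  have hr2 := rad_sq c e
  have h : HasFDerivAt (fun e => Real.sqrt (rad c e)) _ e := (hasFDerivAt_rad hc e).sqrt hr.ne'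
  rw [h.fderiv, metricBilin_apply]
  simp only [smul_apply, add_apply, PiLp.proj_apply, smul_eq_mul]
  set A := w 2 + e 0 * e 3 * w 1 with hA
  set B := w 3 - e 0 * e 2 * w 1 with hB
  set r := rad c e
  -- The `dy` terms of `u α + v β` cancel.
  have h1 : e 2 * w 2 + e 3 * w 3 = e 2 * A + e 3 * B := by rw [hA, hB]; ring
  have h2 : (e 2 * A + e 3 * B) ^ 2 ≤ r ^ 2 * (A * A + B * B) := by
    rw [hr2]
    -- Cauchy-Schwarz: the difference of the two sides is exactly the sum of these three squares.
    nlinarith [sq_nonneg (e 2 * B - e 3 * A), sq_nonneg (c * A), sq_nonneg (c * B)]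
  have h3 : (1 / (2 * Real.sqrt r) * (r⁻¹ * (e 2 * w 2 + e 3 * w 3))) ^ 2 =
      1 / 4 * (r⁻¹ * (r⁻¹ ^ 2 * (e 2 * A + e 3 * B) ^ 2)) := by
    rw [h1, mul_pow, div_pow, mul_pow, Real.sq_sqrt hr.le]
    field_simp
    ring
  have h4 : r⁻¹ ^ 2 * (e 2 * A + e 3 * B) ^ 2 ≤ A * A + B * B := by
    rw [inv_pow, inv_mul_le_iff₀ (by positivity)]
    exact h2
  have h5 := mul_le_mul_of_nonneg_left h4 (inv_pos.2 hr).le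
  have h6 : 0 ≤ r⁻¹ * (A * A + B * B) :=
    mul_nonneg (inv_pos.2 hr).le (add_nonneg (mul_self_nonneg A) (mul_self_nonneg B))
  have h7 : 0 ≤ r * (w 0 * w 0 + w 1 * w 1) :=
    mul_nonneg hr.le (add_nonneg (mul_self_nonneg (w 0)) (mul_self_nonneg (w 1)))
  rw [h3]
  linarith

/-- This is the joint properness of the three Lipschitz functions; `u² + v² ≤ φ² ≤ d⁴` controls the
fibre. -/
lemma norm_sq_le_of_coord_bounds {c a b d : ℝ} {e : Mdl 4} (hc : 0 < c) (h0 : |Real.sqrt c * e 0| ≤ a)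
    (h1 : |Real.sqrt c * e 1| ≤ b) (h2 : |Real.sqrt (rad c e)| ≤ d) :
    ‖e‖ ^ 2 ≤ a ^ 2 / c + b ^ 2 / c + d ^ 4 := by
  have hr := rad_pos hc e
  rw [EuclideanSpace.norm_sq_eq, Fin.sum_univ_four]
  simp only [Real.norm_eq_abs, sq_abs]
  have k0 : e 0 ^ 2 ≤ a ^ 2 / c := by
    rw [le_div_iff₀ hc]
    have := sq_le_sq' (by linarith [abs_nonneg (Real.sqrt c * e 0)]) h0
    rwa [sq_abs, mul_pow, Real.sq_sqrt hc.le, mul_comm] at this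
  have k1 : e 1 ^ 2 ≤ b ^ 2 / c := by
    rw [le_div_iff₀ hc]
    have := sq_le_sq' (by linarith [abs_nonneg (Real.sqrt c * e 1)]) h1
    rwa [sq_abs, mul_pow, Real.sq_sqrt hc.le, mul_comm] at this
  have k2 : rad c e ≤ d ^ 2 := by
    have := sq_le_sq' (by linarith [abs_nonneg (Real.sqrt (rad c e))]) h2
    rwa [sq_abs, Real.sq_sqrt hr.le] at this
  have k3 : rad c e ^ 2 ≤ (d ^ 2) ^ 2 := pow_le_pow_left₀ hr.le k2 2
  rw [rad_sq] at k3
  nlinarith [sq_nonneg c]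

lemma isCompleteMetric_metric {c : ℝ} (hc : 0 < c) : IsCompleteMetric (metric hc) := by
  intro s hs
  obtain ⟨N, hN⟩ := hs 1 one_pos
  have hN' : ∀ i ≥ N, riemDist (metric hc) (s i) (s N) < 1 := fun i hi => hN i hi N le_rfl
  obtain ⟨a, ha⟩ := exists_forall_abs_le_of_cauchy (metric hc)
    (edist_comp_coord_le hc (f := fun e => Real.sqrt c * e 0) (by fun_prop)
      (fderiv_sqrt_mul_coord_sq_le hc 0 (Or.inl rfl))) hN'
  obtain ⟨b, hb⟩ := exists_forall_abs_le_of_cauchy (metric hc)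
    (edist_comp_coord_le hc (f := fun e => Real.sqrt c * e 1) (by fun_prop)
      (fderiv_sqrt_mul_coord_sq_le hc 1 (Or.inr rfl))) hN'
  obtain ⟨d, hd⟩ := exists_forall_abs_le_of_cauchy (metric hc)
    (edist_comp_coord_le hc (f := fun e => Real.sqrt (rad c e))
      ((contDiff_rad hc).sqrt fun e => (rad_pos hc e).ne') (fderiv_sqrt_rad_sq_le hc)) hN'
  -- The bounds hold only from index `N` on, so compactness is applied to the shifted sequence.
  have hball : ∀ i, coord (s (i + N)) ∈
      Metric.closedBall (0 : Mdl 4) (Real.sqrt (a ^ 2 / c + b ^ 2 / c + d ^ 4)) := fun i => by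
    have hi : i + N ≥ N := Nat.le_add_left N i
    rw [mem_closedBall_zero_iff]
    exact Real.le_sqrt_of_sq_le
      (norm_sq_le_of_coord_bounds hc (ha _ hi) (hb _ hi) (hd _ hi))
  obtain ⟨e, -, k, hk, he⟩ := (isCompact_closedBall (0 : Mdl 4) _).tendsto_subseq hball
  refine ⟨ofCoord e, tendsto_riemDist_of_subseq (metric hc) hs (k := fun i => k i + N)
    (Filter.tendsto_atTop_mono (fun i => Nat.le_add_right (k i) N) hk.tendsto_atTop) ?_⟩
  refine ((continuous_ofCoord.tendsto e).comp he).congr fun i => ?_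
  simp [ofCoord_coord]

end HeisBundle

end

theorem theorem2 (c₁ : ℝ) (hc₁ : 0 < c₁) :
    ∃ g : RiemMetric 4 HeisBundle,
      (∀ a u v : Mdl 4, g.inner (HeisBundle.regPt a) (HeisBundle.dReg a u) (HeisBundle.dReg a v) =
        biaxial c₁ a u v) ∧
      IsCompleteMetric g ∧
      (∃ J : AlmostComplex 4 HeisBundle,
        (∀ a : Mdl 4,
          J.J (HeisBundle.regPt a) (HeisBundle.dReg a (fieldQ a)) =
            HeisBundle.dReg a (fieldX₃ a) ∧
          J.J (HeisBundle.regPt a) (HeisBundle.dReg a (fieldX₁ a)) =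
            HeisBundle.dReg a (fieldX₂ a)) ∧
        IsKahler g J ∧
        (∀ a u v : Mdl 4,
          fundForm g J (HeisBundle.regPt a) (HeisBundle.dReg a u) (HeisBundle.dReg a v) =
            biaxialForm c₁ a u v) ∧
        HasCentralCurvature g J 0) ∧
      (∀ p : HeisBundle, ricciDet g p = 0) ∧
      ¬ IsRicciFlat g := by
  refine ⟨HeisBundle.metric hc₁, HeisBundle.metric_dReg hc₁, HeisBundle.isCompleteMetric_metric hc₁,
    ⟨HeisBundle.complexStr, fun a => ⟨HeisBundle.complexStr_dReg_fieldQ a,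
      HeisBundle.complexStr_dReg_fieldX₁ a⟩, HeisBundle.isKahler_metric hc₁,
      HeisBundle.fundForm_dReg hc₁, HeisBundle.hasCentralCurvature_metric hc₁⟩,
    HeisBundle.ricciDet_metric hc₁, HeisBundle.not_isRicciFlat_metric hc₁⟩
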